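/- Let $\ell\in\mathbb Z_{\ge 0}$ and $\mathbb C_+=\{z\in\mathbb C:\operatorname{Re}z>0\}$. Let $A^2_\ell$ be the weighted Bergman space of all analytic $h:\mathbb C_+\to\mathbb C$ with $$\|h\|^2=\frac1\pi\int_{-\infty}^{\infty}\int_0^\infty x^\ell|h(x+iy)|^2\,dx\,dy<\infty .$$ Let $f:\mathbb C_+\to\mathbb C$ and $g:\mathbb C_+\to\mathbb C_+$ be analytic. The maximal weighted composition operator $W_{f,g,\max}$ has domain $\{h\in A^2_\ell: f\cdot(h\circ g)\in A^2_\ell\}$ and acts by $W_{f,g,\max}h=f\cdot(h\circ g)$. Let $W_{f,g}$ be a linear operator in $A^2_\ell$ with $W_{f,g}\preceq W_{f,g,\max}$, that is, the restriction of $W_{f,g,\max}$ to some linear subspace of its domain. Then $W_{f,g}$ is hermitian (densely defined with $W_{f,g}^*=W_{f,g}$, as unbounded operators) if and only if both of the following hold: 1. $W_{f,g}=W_{f,g,\max}$; 2. either $f\equiv 0$ ($g$ being arbitrary), or $(f,g)$ belongs to one of the following families: - (a) $g(w)=\mu$ and $f(w)=\dfrac{\varepsilon}{(w+\overline\mu)^{\ell+2}}$,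 where $\mu\in\mathbb C_+$ and $\varepsilon\in\mathbb R$; - (b) $g(w)=w+\gamma$ and $f(w)=\lambda$, where $\gamma\in\mathbb R_{\ge0}$ and $\lambda\in\mathbb R$; - (c) $g(w)=-\dfrac{\beta}{\alpha}-\dfrac{2}{\alpha w-\overline\beta}$ and $f(w)=\dfrac{\delta}{(\alpha w-\overline\beta)^{\ell+2}}$, where $\alpha,\delta\in\mathbb R\setminus\{0\}$, $\beta\in\mathbb C$, and either $\operatorname{Re}\beta<0<\alpha\le\frac{(\operatorname{Re}\beta)^2}{2}$ or $\alpha<0\le\operatorname{Re}\beta$. Moreover, if $W_{f,g}$ is hermitian, then it is bounded: its domain is all of $A^2_\ell$ and there is $L>0$ with $\|W_{f,g}h\|\le L\|h\|$ for all $h\in A^2_\ell$. -/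

import Mathlib

open MeasureTheory Filter Topology
open scoped ComplexConjugate ENNReal InnerProductSpace

/-- The open right half-plane `{z ∈ ℂ : Re z > 0}`. -/
abbrev RHP : Type := ↥{z : ℂ | 0 < z.re}

/-- A function on the right half-plane is analytic: it is the restriction of a function on `ℂ`
that is complex differentiable on the (open) half-plane. -/
def IsAnalytic (h : RHP → ℂ) : Prop :=
  ∃ H : ℂ → ℂ, DifferentiableOn ℂ H {z : ℂ | 0 < z.re} ∧ ∀ z : RHP, H z = h z

/-- The measure `(1/π) x ^ ℓ dx dy` on the right half-plane, `z = x + iy`. -/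
noncomputable def bergmanMeasure (ℓ : ℕ) : Measure RHP :=
  (Measure.comap ((↑) : RHP → ℂ) volume).withDensity fun z => ENNReal.ofReal ((z : ℂ).re ^ ℓ / Real.pi)

theorem isOpen_rhp : IsOpen {z : ℂ | 0 < z.re} := isOpen_lt continuous_const Complex.continuous_re

theorem IsAnalytic.continuous {h : RHP → ℂ} (hh : IsAnalytic h) : Continuous h := by
  obtain ⟨H, hH, hHh⟩ := hh
  have : h = fun z : RHP => H z := funext fun z => (hHh z).symm
  rw [this]
  exact continuousOn_iff_continuous_domRestrict.1 hH.continuousOn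

/-- The analytic functions on the right half-plane that are square integrable for the measure
`(1/π) x ^ ℓ dx dy`, as a linear subspace of the space of all functions. -/
def bergmanSubmodule (ℓ : ℕ) : Submodule ℂ (RHP → ℂ) where
  carrier := {h | IsAnalytic h ∧ MemLp h 2 (bergmanMeasure ℓ)}
  zero_mem' := ⟨⟨0, differentiableOn_const _, fun _ => rfl⟩, MemLp.zero⟩
  add_mem' := by
    rintro a b ⟨⟨A, hA, hAa⟩, ha⟩ ⟨⟨B, hB, hBb⟩, hb⟩
    exact ⟨⟨A + B, hA.add hB, fun z => by simp [hAa, hBb]⟩, ha.add hb⟩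
  smul_mem' := by
    rintro c a ⟨⟨A, hA, hAa⟩, ha⟩
    exact ⟨⟨c • A, hA.const_smul c, fun z => by simp [hAa]⟩, ha.const_smul c⟩

/-- The weighted Bergman space `A²_ℓ` of the right half-plane. It is a type of its own, so that
its topology is the one of the norm and not the one of pointwise convergence. -/
def BergmanSpace (ℓ : ℕ) : Type := ↥(bergmanSubmodule ℓ)

namespace BergmanSpace

variable {ℓ : ℕ}

noncomputable instance : AddCommGroup (BergmanSpace ℓ) :=
  inferInstanceAs (AddCommGroup ↥(bergmanSubmodule ℓ))

noncomputable instance : Module ℂ (BergmanSpace ℓ) :=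
  inferInstanceAs (Module ℂ ↥(bergmanSubmodule ℓ))

/-- An element of the Bergman space as a function on the half-plane. -/
def toFun (h : BergmanSpace ℓ) : RHP → ℂ := h.1

instance : CoeFun (BergmanSpace ℓ) fun _ => RHP → ℂ := ⟨toFun⟩

/-- The element of the Bergman space given by a function that lies in it. -/
def mk (h : RHP → ℂ) (hh : h ∈ bergmanSubmodule ℓ) : BergmanSpace ℓ := ⟨h, hh⟩

@[simp] theorem mk_apply (h : RHP → ℂ) (hh : h ∈ bergmanSubmodule ℓ) (z : RHP) :
    mk h hh z = h z := rfl

@[simp] theorem add_apply (h k : BergmanSpace ℓ) (z : RHP) : (h + k) z = h z + k z := rfl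

@[simp] theorem sub_apply (h k : BergmanSpace ℓ) (z : RHP) : (h - k) z = h z - k z := rfl

@[simp] theorem smul_apply (c : ℂ) (h : BergmanSpace ℓ) (z : RHP) : (c • h) z = c * h z := rfl

@[simp] theorem zero_apply (z : RHP) : (0 : BergmanSpace ℓ) z = 0 := rfl

theorem isAnalytic (h : BergmanSpace ℓ) : IsAnalytic h := h.2.1

theorem memLp (h : BergmanSpace ℓ) : MemLp h 2 (bergmanMeasure ℓ) := h.2.2

theorem ext {h k : BergmanSpace ℓ} (H : ∀ z, h z = k z) : h = k := Subtype.ext (funext H)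

/-- The inner product `⟨h, k⟩ = (1/π) ∫ x ^ ℓ h(z) conj (k(z)) dx dy`, written with Mathlib's
convention, in which `inner ℂ k h` is linear in `h`. -/
noncomputable instance : Inner ℂ (BergmanSpace ℓ) :=
  ⟨fun k h => ∫ z : RHP, h z * conj (k z) ∂(bergmanMeasure ℓ)⟩

theorem inner_eq_integral (k h : BergmanSpace ℓ) :
    inner ℂ k h = ∫ z : RHP, h z * conj (k z) ∂(bergmanMeasure ℓ) := rfl

/-- The class in `L²` of a function of the Bergman space. -/
noncomputable def toLp (h : BergmanSpace ℓ) : Lp ℂ 2 (bergmanMeasure ℓ) := h.memLp.toLp h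

theorem inner_toLp (k h : BergmanSpace ℓ) : inner ℂ k.toLp h.toLp = inner ℂ k h := by
  rw [L2.inner_def, inner_eq_integral]
  refine integral_congr_ae ?_
  filter_upwards [h.memLp.coeFn_toLp, k.memLp.coeFn_toLp] with z hz kz
  simp only [toLp]
  rw [hz, kz]
  rfl

theorem toLp_add (h k : BergmanSpace ℓ) : (h + k).toLp = h.toLp + k.toLp :=
  MemLp.toLp_add h.memLp k.memLp

theorem toLp_sub (h k : BergmanSpace ℓ) : (h - k).toLp = h.toLp - k.toLp :=
  MemLp.toLp_sub h.memLp k.memLp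

theorem toLp_smul (c : ℂ) (h : BergmanSpace ℓ) : (c • h).toLp = c • h.toLp :=
  MemLp.toLp_const_smul c h.memLp

theorem isOpenPosMeasure_comap :
    Measure.IsOpenPosMeasure (Measure.comap ((↑) : RHP → ℂ) volume) := by
  refine ⟨fun U hU hne => ?_⟩
  obtain ⟨V, hV, rfl⟩ := isOpen_induced_iff.1 hU
  have hm : MeasurableSet {z : ℂ | 0 < z.re} := isOpen_rhp.measurableSet
  rw [comap_subtype_coe_apply hm, Subtype.image_preimage_coe]
  refine ((isOpen_rhp.inter hV).measure_pos volume ?_).ne'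
  obtain ⟨z, hz⟩ := hne
  exact ⟨z, z.2, hz⟩

theorem measurable_density :
    Measurable fun z : RHP => ENNReal.ofReal ((z : ℂ).re ^ ℓ / Real.pi) := by
  have : Continuous fun z : RHP => (z : ℂ).re ^ ℓ / Real.pi := by fun_prop
  exact this.measurable.ennreal_ofReal

theorem comap_absolutelyContinuous :
    Measure.comap ((↑) : RHP → ℂ) volume ≪ bergmanMeasure ℓ := by
  refine withDensity_absolutelyContinuous' measurable_density.aemeasurable ?_
  refine Eventually.of_forall fun z => ?_
  have : 0 < (z : ℂ).re ^ ℓ / Real.pi := div_pos (pow_pos z.2 ℓ) Real.pi_pos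
  simpa using this

theorem eq_of_ae_eq {h k : RHP → ℂ} (hh : Continuous h) (hk : Continuous k)
    (H : h =ᵐ[bergmanMeasure ℓ] k) : h = k :=
  haveI := isOpenPosMeasure_comap
  Measure.eq_of_ae_eq (comap_absolutelyContinuous.ae_eq H) hh hk

theorem toLp_injective : Function.Injective (toLp : BergmanSpace ℓ → _) := by
  intro h k H
  have := (MemLp.toLp_eq_toLp_iff h.memLp k.memLp).1 H
  have := eq_of_ae_eq h.isAnalytic.continuous k.isAnalytic.continuous this
  exact ext fun z => congrFun this z

/-- The axioms of an inner product. -/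
noncomputable abbrev core : InnerProductSpace.Core ℂ (BergmanSpace ℓ) where
  conj_inner_symm h k := by simp only [← inner_toLp]; exact inner_conj_symm _ _
  re_inner_nonneg h := by rw [← inner_toLp]; exact inner_self_nonneg
  add_left h k l := by simp only [← inner_toLp, toLp_add]; exact inner_add_left _ _ _
  smul_left h k c := by simp only [← inner_toLp, toLp_smul]; exact inner_smul_left _ _ _
  definite h H := by
    rw [← inner_toLp, inner_self_eq_zero] at H
    refine toLp_injective (H.trans ?_)
    exact (MemLp.toLp_zero (MemLp.zero : MemLp 0 2 (bergmanMeasure ℓ))).symm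

noncomputable instance : NormedAddCommGroup (BergmanSpace ℓ) :=
  core.toNormedAddCommGroup

noncomputable instance : InnerProductSpace ℂ (BergmanSpace ℓ) :=
  InnerProductSpace.ofCore core.toCore

theorem norm_toLp (h : BergmanSpace ℓ) : ‖h.toLp‖ = ‖h‖ := by
  rw [norm_eq_sqrt_re_inner (𝕜 := ℂ), norm_eq_sqrt_re_inner (𝕜 := ℂ), inner_toLp]

theorem circle_bound {H : ℂ → ℂ} {c : ℂ} {r ρ : ℝ}
    (hH : DifferentiableOn ℂ H (Metric.ball c r)) (h0 : 0 < ρ) (hρ : ρ < r) :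
    ENNReal.ofReal (2 * Real.pi) * ‖H c‖ₑ ≤
      ∫⁻ θ in Set.Ioo (-Real.pi) Real.pi, ‖H (circleMap c ρ θ)‖ₑ := by
  have hcl : DiffContOnCl ℂ H (Metric.ball c |ρ|) := by
    rw [abs_of_pos h0]
    refine (hH.mono ?_).diffContOnCl
    rw [closure_ball c h0.ne']
    exact Metric.closedBall_subset_ball hρ
  have h1 := hcl.circleAverage
  rw [Real.circleAverage_def] at h1
  have hper : Function.Periodic (fun θ => H (circleMap c ρ θ)) (2 * Real.pi) := fun θ => by
    simp only [periodic_circleMap c ρ θ]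
  have h2 := hper.intervalIntegral_add_eq 0 (-Real.pi)
  rw [zero_add, show -Real.pi + 2 * Real.pi = Real.pi by ring] at h2
  rw [h2, intervalIntegral.integral_of_le (by linarith [Real.pi_pos]),
    integral_Ioc_eq_integral_Ioo] at h1
  rw [← h1, enorm_smul, Real.enorm_of_nonneg (by positivity), ← mul_assoc,
    ← ENNReal.ofReal_mul (by positivity), mul_inv_cancel₀ (by positivity), ENNReal.ofReal_one,
    one_mul]
  exact enorm_integral_le_lintegral_enorm _

theorem mean_value_bound {H : ℂ → ℂ} {c : ℂ} {r : ℝ} (hr : 0 < r)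
    (hH : DifferentiableOn ℂ H (Metric.ball c r)) :
    ENNReal.ofReal (r ^ 2) * ‖H c‖ₑ ≤ ∫⁻ z in Metric.ball c r, ‖H z‖ₑ := by
  classical
  set G : ℂ → ℝ≥0∞ := (Metric.ball c r).indicator fun z => ‖H z‖ₑ with hG
  have hGm : Measurable G := by
    have h1 : Measurable ((Metric.ball c r).indicator H) := by
      rw [← Set.piecewise_eq_indicator]
      exact hH.continuousOn.measurable_piecewise continuousOn_const
        Metric.isOpen_ball.measurableSet
    have h2 : G = fun z => ‖(Metric.ball c r).indicator H z‖ₑ := by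
      funext z
      by_cases hz : z ∈ Metric.ball c r <;> simp [hG, hz]
    rw [h2]
    exact h1.enorm
  rw [← lintegral_indicator Metric.isOpen_ball.measurableSet, ← hG,
    ← lintegral_add_left_eq_self G c, ← Complex.lintegral_comp_polarCoord_symm,
    polarCoord_target, Measure.volume_eq_prod, ← Measure.prod_restrict, lintegral_prod]
  · have key : ∀ ρ ∈ Set.Ioo (r / 2) r, ENNReal.ofReal (r / 2) *
        (ENNReal.ofReal (2 * Real.pi) * ‖H c‖ₑ) ≤
        ∫⁻ θ in Set.Ioo (-Real.pi) Real.pi,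
          ENNReal.ofReal ρ • G (c + Complex.polarCoord.symm (ρ, θ)) := by
      intro ρ hρ
      have hρ0 : 0 < ρ := by linarith [hρ.1]
      simp only [smul_eq_mul]
      rw [lintegral_const_mul' _ _ ENNReal.ofReal_ne_top]
      refine mul_le_mul' (ENNReal.ofReal_le_ofReal hρ.1.le) ?_
      refine (circle_bound hH hρ0 hρ.2).trans (le_of_eq ?_)
      refine lintegral_congr fun θ => ?_
      have e : c + Complex.polarCoord.symm (ρ, θ) = circleMap c ρ θ := by
        rw [Complex.polarCoord_symm_apply, circleMap, Complex.exp_mul_I]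
        push_cast
        ring
      have hm : circleMap c ρ θ ∈ Metric.ball c r := by
        rw [Metric.mem_ball, dist_eq_norm]
        simpa [abs_of_pos hρ0] using hρ.2
      rw [e, hG, Set.indicator_of_mem hm]
    calc ENNReal.ofReal (r ^ 2) * ‖H c‖ₑ
        ≤ ∫⁻ _ in Set.Ioo (r / 2) r, ENNReal.ofReal (r / 2) *
          (ENNReal.ofReal (2 * Real.pi) * ‖H c‖ₑ) := by
          rw [setLIntegral_const, Real.volume_Ioo, ← mul_assoc, mul_right_comm,
            ← ENNReal.ofReal_mul (by positivity), ← ENNReal.ofReal_mul (by positivity)]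
          gcongr
          nlinarith [Real.pi_gt_three, sq_nonneg r]
      _ ≤ ∫⁻ ρ in Set.Ioo (r / 2) r, ∫⁻ θ in Set.Ioo (-Real.pi) Real.pi,
          ENNReal.ofReal ρ • G (c + Complex.polarCoord.symm (ρ, θ)) :=
          setLIntegral_mono' measurableSet_Ioo key
      _ ≤ _ := lintegral_mono_set fun ρ hρ => lt_trans (by linarith) hρ.1
  · simp only [smul_eq_mul]
    refine (Measurable.mul ?_ ?_).aemeasurable
    · exact measurable_fst.ennreal_ofReal
    · refine hGm.comp (measurable_const.add ?_)
      have : Continuous fun p : ℝ × ℝ => Complex.polarCoord.symm p := by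
        simp only [Complex.polarCoord_symm_apply]
        fun_prop
      exact this.measurable

theorem setLIntegral_le (h : BergmanSpace ℓ) {H : ℂ → ℂ} (hH : ∀ z : RHP, H z = h z) {c : ℂ}
    {r a : ℝ} (ha : 0 < a) (hc : ∀ z ∈ Metric.ball c r, a ≤ z.re) :
    ENNReal.ofReal (a ^ ℓ / Real.pi) * ∫⁻ z in Metric.ball c r, ‖H z‖ₑ ^ 2 ≤
      ENNReal.ofReal (‖h‖ ^ 2) := by
  have h1 : ENNReal.ofReal (‖h‖ ^ 2) = ∫⁻ z, ‖h z‖ₑ ^ 2 ∂(bergmanMeasure ℓ) := by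
    have h2 := eLpNorm_nnreal_pow_eq_lintegral (μ := bergmanMeasure ℓ) (f := h.toFun)
      (p := 2) (by norm_num)
    have h3 : ENNReal.ofReal ‖h‖ = eLpNorm h.toFun 2 (bergmanMeasure ℓ) := by
      rw [← norm_toLp, toLp, Lp.norm_toLp, ENNReal.ofReal_toReal h.memLp.2.ne]
    rw [ENNReal.ofReal_pow (norm_nonneg _), h3]
    simpa using h2
  have hmeas : Measurable fun z : RHP => ‖h z‖ₑ ^ 2 :=
    (h.isAnalytic.continuous.measurable.enorm).pow_const 2
  rw [h1, bergmanMeasure, lintegral_withDensity_eq_lintegral_mul _ measurable_density hmeas]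
  have h4 : ∀ z : RHP, ((fun z : RHP => ENNReal.ofReal ((z : ℂ).re ^ ℓ / Real.pi)) *
      fun z : RHP => ‖h z‖ₑ ^ 2) z =
      (fun z : ℂ => ENNReal.ofReal (z.re ^ ℓ / Real.pi) * ‖H z‖ₑ ^ 2) z := fun z => by
    simp [hH]
  have h5 := lintegral_subtype_comap (μ := volume) isOpen_rhp.measurableSet
    fun z : ℂ => ENNReal.ofReal (z.re ^ ℓ / Real.pi) * ‖H z‖ₑ ^ 2
  rw [lintegral_congr h4]
  refine le_of_le_of_eq ?_ h5.symm
  rw [← lintegral_const_mul' _ _ ENNReal.ofReal_ne_top]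
  refine le_trans (setLIntegral_mono' Metric.isOpen_ball.measurableSet fun z hz => ?_)
    (lintegral_mono_set fun z hz => lt_of_lt_of_le ha (hc z hz))
  have := hc z hz
  gcongr

theorem pointwise_bound (ℓ : ℕ) (z₀ : RHP) : ∃ r > 0, ∃ C : ℝ, ∀ (h : BergmanSpace ℓ) (z : RHP),
    (z : ℂ) ∈ Metric.ball (z₀ : ℂ) r → ‖h z‖ ≤ C * ‖h‖ := by
  obtain ⟨c, hc⟩ := z₀
  have hc : 0 < c.re := hc
  set r := c.re / 4 with hr
  have hr0 : 0 < r := by positivity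
  set A : ℝ := (c.re / 2) ^ ℓ / Real.pi * r ^ 2 with hA
  have hA0 : 0 < A := by have := Real.pi_pos; positivity
  refine ⟨r, hr0, √(A⁻¹), fun h z hz => ?_⟩
  obtain ⟨H, hHd, hH⟩ := h.isAnalytic
  have hball : ∀ w ∈ Metric.ball (z : ℂ) r, c.re / 2 ≤ w.re := by
    intro w hw
    have h1 : dist w c < r + r := lt_of_le_of_lt (dist_triangle _ _ _) (add_lt_add hw hz)
    rw [dist_eq_norm] at h1
    have h2 := (Complex.abs_re_le_norm (w - c)).trans h1.le
    rw [Complex.sub_re, abs_le] at h2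
    linarith [h2.1]
  have h1 := setLIntegral_le h hH (by positivity : 0 < c.re / 2) hball
  have hd : DifferentiableOn ℂ (fun z => H z ^ 2) (Metric.ball (z : ℂ) r) :=
    (hHd.mono fun w hw => lt_of_lt_of_le (by positivity : 0 < c.re / 2) (hball w hw)).pow 2
  have h2 := mean_value_bound hr0 hd
  simp only [enorm_pow] at h2
  have h3 := (mul_le_mul_right h2 (ENNReal.ofReal ((c.re / 2) ^ ℓ / Real.pi))).trans h1
  rw [← mul_assoc, ← ENNReal.ofReal_mul (by have := Real.pi_pos; positivity), ← hA, hH,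
    ← ofReal_norm, ← ENNReal.ofReal_pow (norm_nonneg _), ← ENNReal.ofReal_mul hA0.le,
    ENNReal.ofReal_le_ofReal_iff (by positivity)] at h3
  refine abs_le_of_sq_le_sq' ?_ (by positivity) |>.2
  rw [mul_pow, Real.sq_sqrt (by positivity), inv_mul_eq_div, le_div_iff₀ hA0]
  linarith

/-- The Bergman space is a Hilbert space. -/
instance : CompleteSpace (BergmanSpace ℓ) := by
  refine Metric.complete_of_cauchySeq_tendsto fun u hu => ?_
  have hdist : ∀ h k : BergmanSpace ℓ, dist h.toLp k.toLp = dist h k := fun h k => by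
    rw [dist_eq_norm, dist_eq_norm, ← toLp_sub, norm_toLp]
  have hcL : CauchySeq fun n => (u n).toLp := by
    rw [Metric.cauchySeq_iff] at hu ⊢
    simpa only [hdist] using hu
  obtain ⟨v, hv⟩ := cauchySeq_tendsto_of_complete hcL
  -- the sequence converges locally uniformly
  choose U hU hUu using fun n => (u n).isAnalytic
  have hloc : ∀ z₀ : RHP, ∃ r > 0, UniformCauchySeqOn U atTop
      (Metric.ball (z₀ : ℂ) r ∩ {z : ℂ | 0 < z.re}) := by
    intro z₀
    obtain ⟨r, hr, C, hC⟩ := pointwise_bound ℓ z₀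
    refine ⟨r, hr, ?_⟩
    rw [Metric.uniformCauchySeqOn_iff]
    intro ε hε
    obtain ⟨N, hN⟩ := Metric.cauchySeq_iff.1 hu (ε / (|C| + 1)) (by positivity)
    refine ⟨N, fun m hm n hn z hz => ?_⟩
    have h1 := hC (u m - u n) ⟨z, hz.2⟩ hz.1
    have h2 := hN m hm n hn
    rw [dist_eq_norm] at h2 ⊢
    have e1 := hUu m ⟨z, hz.2⟩
    have e2 := hUu n ⟨z, hz.2⟩
    simp only at e1 e2
    rw [e1, e2]
    rw [lt_div_iff₀ (by positivity)] at h2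
    rw [sub_apply] at h1
    have h3 : C * ‖u m - u n‖ ≤ |C| * ‖u m - u n‖ :=
      mul_le_mul_of_nonneg_right (le_abs_self C) (norm_nonneg _)
    nlinarith [norm_nonneg (u m - u n)]
  have hpt : ∀ z : ℂ, ∃ w : ℂ, 0 < z.re → Tendsto (fun n => U n z) atTop (𝓝 w) := by
    intro z
    by_cases hz : 0 < z.re
    · obtain ⟨r, hr, h⟩ := hloc ⟨z, hz⟩
      obtain ⟨w, hw⟩ := cauchySeq_tendsto_of_complete (h.cauchySeq ⟨Metric.mem_ball_self hr, hz⟩)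
      exact ⟨w, fun _ => hw⟩
    · exact ⟨0, fun h => absurd h hz⟩
  choose F hF using hpt
  have hlu : TendstoLocallyUniformlyOn U F atTop {z : ℂ | 0 < z.re} := by
    refine tendstoLocallyUniformlyOn_of_forall_exists_nhds fun z hz => ?_
    obtain ⟨r, hr, h⟩ := hloc ⟨z, hz⟩
    refine ⟨Metric.ball z r ∩ {z : ℂ | 0 < z.re},
      inter_mem (mem_nhdsWithin_of_mem_nhds (Metric.ball_mem_nhds z hr)) self_mem_nhdsWithin, ?_⟩
    exact h.tendstoUniformlyOn_of_tendsto fun w hw => hF w hw.2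
  have hFd : DifferentiableOn ℂ F {z : ℂ | 0 < z.re} :=
    hlu.differentiableOn (Eventually.of_forall hU) isOpen_rhp
  have hFa : IsAnalytic fun z : RHP => F z := ⟨F, hFd, fun _ => rfl⟩
  -- the limit in `L²` is the locally uniform limit
  have hae : (fun z : RHP => F z) =ᵐ[bergmanMeasure ℓ] v := by
    obtain ⟨ns, hns, hlim⟩ := (tendstoInMeasure_of_tendsto_Lp hv).exists_seq_tendsto_ae
    have hall : ∀ᵐ z ∂(bergmanMeasure ℓ), ∀ n, (u n).toLp z = u n z :=
      ae_all_iff.2 fun n => (u n).memLp.coeFn_toLp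
    filter_upwards [hlim, hall] with z hz hz'
    refine tendsto_nhds_unique ?_ hz
    have := (hF z z.2).comp hns.tendsto_atTop
    refine this.congr fun n => ?_
    simp only [Function.comp_apply]
    rw [hz', hUu]
  have hFm : MemLp (fun z : RHP => F z) 2 (bergmanMeasure ℓ) :=
    (memLp_congr_ae hae).2 (Lp.memLp v)
  refine ⟨mk (fun z : RHP => F z) ⟨hFa, hFm⟩, ?_⟩
  have hv' : (mk (fun z : RHP => F z) ⟨hFa, hFm⟩ : BergmanSpace ℓ).toLp = v := by
    refine Lp.ext ?_
    exact (MemLp.coeFn_toLp _).trans hae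
  rw [tendsto_iff_dist_tendsto_zero] at hv ⊢
  rw [← hv'] at hv
  simpa only [hdist] using hv

end BergmanSpace

/-- The weighted composition expression `h ↦ f · (h ∘ g)`. -/
def weightedComp (f : RHP → ℂ) (g : RHP → RHP) (h : RHP → ℂ) : RHP → ℂ :=
  fun z => f z * h (g z)

/-- The maximal weighted composition operator on `A²_ℓ`: its domain consists of all `h` in the
space for which `f · (h ∘ g)` lies in the space. -/
def maxWeightedComp (ℓ : ℕ) (f : RHP → ℂ) (g : RHP → RHP) :
    BergmanSpace ℓ →ₗ.[ℂ] BergmanSpace ℓ where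
  domain :=
    { carrier := {h | weightedComp f g h ∈ bergmanSubmodule ℓ}
      zero_mem' := by
        have : weightedComp f g (0 : BergmanSpace ℓ) = 0 := by
          funext z; simp [weightedComp]
        simp only [Set.mem_ofPred_eq, this, zero_mem]
      add_mem' := by
        intro a b ha hb
        have : weightedComp f g (a + b : BergmanSpace ℓ) =
            weightedComp f g a + weightedComp f g b := by
          funext z; simp [weightedComp, mul_add]
        simp only [Set.mem_ofPred_eq] at ha hb ⊢
        rw [this]
        exact add_mem ha hb
      smul_mem' := by
        intro c a ha
        have : weightedComp f g (c • a : BergmanSpace ℓ) = c • weightedComp f g a := by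
          funext z; simp [weightedComp, mul_left_comm]
        simp only [Set.mem_ofPred_eq] at ha ⊢
        rw [this]
        exact Submodule.smul_mem _ c ha }
  toFun :=
    { toFun := fun h => BergmanSpace.mk (weightedComp f g (h : BergmanSpace ℓ)) h.2
      map_add' := fun a b => BergmanSpace.ext fun z => by simp [weightedComp, mul_add]
      map_smul' := fun c a => BergmanSpace.ext fun z => by simp [weightedComp, mul_left_comm] }

theorem mem_maxWeightedComp_domain {ℓ : ℕ} {f : RHP → ℂ} {g : RHP → RHP} {h : BergmanSpace ℓ} :
    h ∈ (maxWeightedComp ℓ f g).domain ↔ weightedComp f g h ∈ bergmanSubmodule ℓ := Iff.rfl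

theorem maxWeightedComp_apply {ℓ : ℕ} {f : RHP → ℂ} {g : RHP → RHP}
    (h : (maxWeightedComp ℓ f g).domain) (z : RHP) :
    maxWeightedComp ℓ f g h z = f z * (h : BergmanSpace ℓ) (g z) := rfl

/-- A linear operator with domain in `A²_ℓ` is bounded if it is defined everywhere and its norm is
finite. -/
def IsBoundedOperator {ℓ : ℕ} (W : BergmanSpace ℓ →ₗ.[ℂ] BergmanSpace ℓ) : Prop :=
  W.domain = ⊤ ∧ ∃ L : ℝ, 0 < L ∧ ∀ h : W.domain, ‖W h‖ ≤ L * ‖(h : BergmanSpace ℓ)‖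

/-- First hermitian family: `g` is constant. -/
def HermitianFamilyConst (ℓ : ℕ) (f : RHP → ℂ) (g : RHP → RHP) : Prop :=
  ∃ (μ : ℂ) (ε : ℝ), 0 < μ.re ∧
    ∀ w : RHP, (g w : ℂ) = μ ∧ f w = ε / ((w : ℂ) + conj μ) ^ (ℓ + 2)

/-- Second hermitian family: `g` is a translation and `f` is constant. -/
def HermitianFamilyTranslation (f : RHP → ℂ) (g : RHP → RHP) : Prop :=
  ∃ γ c : ℝ, 0 ≤ γ ∧ ∀ w : RHP, (g w : ℂ) = w + γ ∧ f w = c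

/-- Third hermitian family: `g` is a nonconstant linear fractional map with a finite pole. -/
def HermitianFamilyFractional (ℓ : ℕ) (f : RHP → ℂ) (g : RHP → RHP) : Prop :=
  ∃ (α δ : ℝ) (β : ℂ), α ≠ 0 ∧ δ ≠ 0 ∧
    ((β.re < 0 ∧ 0 < α ∧ α ≤ β.re ^ 2 / 2) ∨ (α < 0 ∧ 0 ≤ β.re)) ∧
    ∀ w : RHP, (g w : ℂ) = -β / α - 2 / (α * w - conj β) ∧
      f w = δ / (α * w - conj β) ^ (ℓ + 2)

/-! Up to a constant factor, the reproducing kernel of `A²_ℓ` at `w` is `K_w(z) = (z + conj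
w)^(-(ℓ+2))`. A conformal map of the disc onto the half-plane taking `0` to `w` reduces this to the
mean value property for the radial weight `(1 - |ζ|²)^ℓ`.

If a restriction `W` of the maximal operator is self-adjoint, then `x ↦ ⟨K_w, W x⟩` is represented
by `conj (f w) • K_{g w}`. Hence `K_w` lies in the domain of `W* = W`, and evaluating `W K_w = conj
(f w) • K_{g w}` at `z` gives the symmetric identity `HermitianKernelIdentity (ℓ + 2) f g`.

This identity is rigid. Its logarithmic derivative in `z` at the single point `1` eliminates the
unknown power and expresses `g w` as a linear fractional function of `w`; `f` is then a constant
times the power `-(ℓ+2)` of the denominator. Reinserting this form forces the symmetry of the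
coefficients, and the condition that `g` preserves the half-plane yields the inequalities on the
parameters.

Conversely, each family satisfies the identity and gives an everywhere defined bounded operator:
finite rank for constant `g`, a change of variables otherwise (`IsBoundedOperator.of_injOn`).
Pairing with kernels shows that the adjoint acts by the same formula. Thus the maximal operator is
self-adjoint, and a self-adjoint operator has no proper self-adjoint extension, so `W` equals it. -/

/-! ### Holomorphic change of variables in the plane -/

theorem abs_det_restrictScalars_toSpanSingleton (c : ℂ) :
    |(((ContinuousLinearMap.toSpanSingleton ℂ c).restrictScalars ℝ : ℂ →L[ℝ] ℂ)).det| =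
      ‖c‖ ^ 2 := by
  have : (((ContinuousLinearMap.toSpanSingleton ℂ c).restrictScalars ℝ : ℂ →L[ℝ] ℂ)).det =
      ‖c‖ ^ 2 := by
    simp [ContinuousLinearMap.det, LinearMap.det_restrictScalars,
      Algebra.norm_complex_eq, Complex.normSq_eq_norm_sq]
  rw [this, abs_of_nonneg (by positivity)]

/-- The real Jacobian of a holomorphic map is the squared modulus of its complex derivative. -/
theorem lintegral_image_eq_lintegral_normSq_deriv_mul {s : Set ℂ} (hs : MeasurableSet s)
    {φ φ' : ℂ → ℂ} (hφ : ∀ z ∈ s, HasDerivAt φ (φ' z) z) (hinj : Set.InjOn φ s)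
    (u : ℂ → ℝ≥0∞) :
    ∫⁻ z in φ '' s, u z = ∫⁻ z in s, ENNReal.ofReal (‖φ' z‖ ^ 2) * u (φ z) := by
  rw [lintegral_image_eq_lintegral_abs_det_fderiv_mul volume hs
    (fun z hz => ((hφ z hz).hasFDerivAt.restrictScalars ℝ).hasFDerivWithinAt) hinj u]
  simp only [abs_det_restrictScalars_toSpanSingleton]

theorem integral_image_eq_integral_normSq_deriv_smul {s : Set ℂ} (hs : MeasurableSet s)
    {φ φ' : ℂ → ℂ} (hφ : ∀ z ∈ s, HasDerivAt φ (φ' z) z) (hinj : Set.InjOn φ s)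
    (u : ℂ → ℂ) :
    ∫ z in φ '' s, u z = ∫ z in s, (‖φ' z‖ ^ 2) • u (φ z) := by
  rw [integral_image_eq_integral_abs_det_fderiv_smul volume hs
    (fun z hz => ((hφ z hz).hasFDerivAt.restrictScalars ℝ).hasFDerivWithinAt) hinj u]
  simp only [abs_det_restrictScalars_toSpanSingleton]

theorem integrableOn_image_iff_integrableOn_normSq_deriv_smul {s : Set ℂ} (hs : MeasurableSet s)
    {φ φ' : ℂ → ℂ} (hφ : ∀ z ∈ s, HasDerivAt φ (φ' z) z) (hinj : Set.InjOn φ s)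
    (u : ℂ → ℂ) :
    IntegrableOn u (φ '' s) ↔ IntegrableOn (fun z => (‖φ' z‖ ^ 2) • u (φ z)) s := by
  rw [integrableOn_image_iff_integrableOn_abs_det_fderiv_smul volume hs
    (fun z hz => ((hφ z hz).hasFDerivAt.restrictScalars ℝ).hasFDerivWithinAt) hinj u]
  simp only [abs_det_restrictScalars_toSpanSingleton]

/-! ### Weighted mean value property on the disc -/

theorem integral_polar_weight (ℓ : ℕ) :
    ∫ r in (0 : ℝ)..1, r * (1 - r ^ 2) ^ ℓ = 1 / (2 * ((ℓ : ℝ) + 1)) := by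
  have h : ∀ r ∈ Set.uIcc (0 : ℝ) 1, HasDerivAt
      (fun r : ℝ => -(1 - r ^ 2) ^ (ℓ + 1) / (2 * (ℓ + 1))) (r * (1 - r ^ 2) ^ ℓ) r := by
    intro r _
    have h1 : HasDerivAt (fun r : ℝ => 1 - r ^ 2) (-(2 * r)) r := by
      simpa using ((hasDerivAt_id r).pow 2).const_sub 1
    refine ((h1.pow (ℓ + 1)).neg.div_const (2 * ((ℓ : ℝ) + 1))).congr_deriv ?_
    have : (ℓ : ℝ) + 1 ≠ 0 := by positivity
    rw [Nat.add_sub_cancel]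
    push_cast
    field_simp
  rw [intervalIntegral.integral_eq_sub_of_hasDerivAt h
    (Continuous.intervalIntegrable (by fun_prop) _ _)]
  simp [neg_div]

/-- The weighted mean value property on the unit disc. -/
theorem integral_ball_weight_smul (ℓ : ℕ) {H : ℂ → ℂ}
    (hH : DifferentiableOn ℂ H (Metric.ball 0 1))
    (hint : IntegrableOn (fun z => ((1 - ‖z‖ ^ 2) ^ ℓ) • H z) (Metric.ball 0 1)) :
    ∫ z in Metric.ball (0 : ℂ) 1, ((1 - ‖z‖ ^ 2) ^ ℓ) • H z = (Real.pi / (ℓ + 1)) • H 0 := by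
  classical
  set G : ℂ → ℂ := (Metric.ball (0 : ℂ) 1).indicator fun z => ((1 - ‖z‖ ^ 2) ^ ℓ) • H z with hG
  have hGm : Measurable G := by
    rw [hG, ← Set.piecewise_eq_indicator]
    exact ContinuousOn.measurable_piecewise (by have := hH.continuousOn; fun_prop)
      continuousOn_const Metric.isOpen_ball.measurableSet
  have hGi : Integrable G := hint.integrable_indicator Metric.isOpen_ball.measurableSet
  have hpm : Measurable fun p : ℝ × ℝ => Complex.polarCoord.symm p := by
    have : Continuous fun p : ℝ × ℝ => Complex.polarCoord.symm p := by
      simp only [Complex.polarCoord_symm_apply]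
      fun_prop
    exact this.measurable
  -- Integrability for Fubini comes from the polar formula for nonnegative integrands, applied to
  -- the norm of `G`.
  have hpi : IntegrableOn (fun p : ℝ × ℝ => p.1 • G (Complex.polarCoord.symm p))
      polarCoord.target := by
    refine ⟨((measurable_fst.smul (hGm.comp hpm))).aestronglyMeasurable, ?_⟩
    have h1 := hGi.2
    rw [HasFiniteIntegral, ← Complex.lintegral_comp_polarCoord_symm] at h1
    refine lt_of_le_of_lt (le_of_eq ?_) h1
    refine setLIntegral_congr_fun polarCoord.open_target.measurableSet fun p hp => ?_
    rw [polarCoord_target] at hp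
    simp only [enorm_smul, smul_eq_mul]
    rw [Real.enorm_of_nonneg (le_of_lt hp.1)]
  rw [← integral_indicator Metric.isOpen_ball.measurableSet, ← hG,
    ← Complex.integral_comp_polarCoord_symm]
  rw [polarCoord_target, Measure.volume_eq_prod] at hpi ⊢
  rw [setIntegral_prod _ hpi]
  -- The weight is constant on each circle, so the unweighted mean value property applies there;
  -- circles of radius at least `1` contribute nothing.
  have hinner : ∀ r ∈ Set.Ioi (0 : ℝ), ∫ θ in Set.Ioo (-Real.pi) Real.pi,
      r • G (Complex.polarCoord.symm (r, θ)) =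
      (Set.Iio (1 : ℝ)).indicator (fun r => ((2 * Real.pi) * (r * (1 - r ^ 2) ^ ℓ)) • H 0) r := by
    intro r hr
    have hr : 0 < r := hr
    have e : ∀ θ, Complex.polarCoord.symm (r, θ) = circleMap 0 r θ := fun θ => by
      rw [Complex.polarCoord_symm_apply, circleMap, Complex.exp_mul_I]
      push_cast
      ring
    have en : ∀ θ, ‖circleMap 0 r θ‖ = r := fun θ => by simp [abs_of_pos hr]
    simp only [e]
    by_cases h1 : r < 1
    · have hm : ∀ θ, circleMap 0 r θ ∈ Metric.ball (0 : ℂ) 1 := fun θ => by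
        rw [mem_ball_zero_iff, en]; exact h1
      rw [Set.indicator_of_mem (Set.mem_Iio.2 h1)]
      simp only [hG, Set.indicator_of_mem (hm _), en]
      have hcl : DiffContOnCl ℂ H (Metric.ball 0 |r|) := by
        rw [abs_of_pos hr]
        refine (hH.mono ?_).diffContOnCl
        rw [closure_ball _ hr.ne']
        exact Metric.closedBall_subset_ball h1
      have h2 := hcl.circleAverage
      have hper : Function.Periodic (fun θ => H (circleMap 0 r θ)) (2 * Real.pi) := fun θ => by
        simp only [periodic_circleMap 0 r θ]
      have h3 := hper.intervalIntegral_add_eq 0 (-Real.pi)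
      rw [zero_add, show -Real.pi + 2 * Real.pi = Real.pi by ring] at h3
      rw [Real.circleAverage_def, h3,
        intervalIntegral.integral_of_le (by linarith [Real.pi_pos]),
        integral_Ioc_eq_integral_Ioo] at h2
      rw [integral_smul, integral_smul, ← h2, smul_smul, smul_smul]
      congr 1
      have := Real.pi_pos
      field_simp
    · rw [Set.indicator_of_notMem (by simpa using h1)]
      have hm : ∀ θ, circleMap 0 r θ ∉ Metric.ball (0 : ℂ) 1 := fun θ => by
        rw [mem_ball_zero_iff, en]; exact h1
      simp only [hG, Set.indicator_of_notMem (hm _), smul_zero, integral_zero]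
  rw [setIntegral_congr_fun measurableSet_Ioi hinner, setIntegral_indicator measurableSet_Iio,
    Set.Ioi_inter_Iio, ← integral_Ioc_eq_integral_Ioo,
    ← intervalIntegral.integral_of_le zero_le_one, intervalIntegral.integral_smul_const,
    intervalIntegral.integral_const_mul, integral_polar_weight]
  congr 1
  field_simp

/-! ### Bergman integrals as planar integrals -/

theorem lintegral_bergmanMeasure (ℓ : ℕ) {u : RHP → ℝ≥0∞} {U : ℂ → ℝ≥0∞}
    (hU : ∀ z : RHP, U z = u z) :
    ∫⁻ z, u z ∂(bergmanMeasure ℓ) =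
      ∫⁻ z in {z : ℂ | 0 < z.re}, ENNReal.ofReal (z.re ^ ℓ / Real.pi) * U z := by
  rw [bergmanMeasure, lintegral_withDensity_eq_lintegral_mul_non_measurable _
    BergmanSpace.measurable_density (Eventually.of_forall fun _ => ENNReal.ofReal_lt_top),
    ← lintegral_subtype_comap isOpen_rhp.measurableSet]
  refine lintegral_congr fun z => ?_
  simp [hU]

theorem integral_bergmanMeasure (ℓ : ℕ) {u : RHP → ℂ} {U : ℂ → ℂ} (hU : ∀ z : RHP, U z = u z) :
    ∫ z, u z ∂(bergmanMeasure ℓ) =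
      ∫ z in {z : ℂ | 0 < z.re}, (z.re ^ ℓ / Real.pi) • U z := by
  rw [bergmanMeasure, integral_withDensity_eq_integral_toReal_smul
    BergmanSpace.measurable_density (Eventually.of_forall fun _ => ENNReal.ofReal_lt_top),
    ← integral_subtype_comap isOpen_rhp.measurableSet]
  refine integral_congr_ae (Eventually.of_forall fun z => ?_)
  have : 0 ≤ (z : ℂ).re ^ ℓ / Real.pi := div_nonneg (pow_nonneg (le_of_lt z.2) ℓ) Real.pi_pos.le
  simp only [hU, ENNReal.toReal_ofReal this]

theorem integrable_bergmanMeasure_iff (ℓ : ℕ) {u : RHP → ℂ} {U : ℂ → ℂ}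
    (hU : ∀ z : RHP, U z = u z) :
    Integrable u (bergmanMeasure ℓ) ↔
      IntegrableOn (fun z => (z.re ^ ℓ / Real.pi) • U z) {z : ℂ | 0 < z.re} := by
  rw [bergmanMeasure, integrable_withDensity_iff_integrable_smul'
    BergmanSpace.measurable_density (Eventually.of_forall fun _ => ENNReal.ofReal_lt_top),
    IntegrableOn, ← map_comap_subtype_coe isOpen_rhp.measurableSet,
    (MeasurableEmbedding.subtype_coe isOpen_rhp.measurableSet).integrable_map_iff]
  refine integrable_congr (Eventually.of_forall fun z => ?_)
  have : 0 ≤ (z : ℂ).re ^ ℓ / Real.pi := div_nonneg (pow_nonneg (le_of_lt z.2) ℓ) Real.pi_pos.le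
  simp only [hU, ENNReal.toReal_ofReal this, Function.comp_apply]

/-! ### The disc model of the half-plane -/

/-- The conformal map of the unit disc onto the right half-plane that takes `0` to `w`. -/
noncomputable def discToRHP (w ζ : ℂ) : ℂ := (w + conj w * ζ) / (1 - ζ)

theorem one_sub_ne_zero_of_mem_ball {ζ : ℂ} (hζ : ζ ∈ Metric.ball (0 : ℂ) 1) : 1 - ζ ≠ 0 := by
  intro h
  rw [mem_ball_zero_iff, ← sub_eq_zero.1 h] at hζ
  simp at hζ

theorem add_conj_ne_zero {z w : ℂ} (hz : 0 < z.re) (hw : 0 < w.re) : z + conj w ≠ 0 := by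
  intro h
  have := congrArg Complex.re h
  simp at this
  linarith

theorem discToRHP_add_conj (w : ℂ) {ζ : ℂ} (hζ : ζ ∈ Metric.ball (0 : ℂ) 1) :
    discToRHP w ζ + conj w = (w + conj w) / (1 - ζ) := by
  have := one_sub_ne_zero_of_mem_ball hζ
  rw [discToRHP]
  field_simp
  ring

theorem hasDerivAt_discToRHP (w : ℂ) {ζ : ℂ} (hζ : ζ ∈ Metric.ball (0 : ℂ) 1) :
    HasDerivAt (discToRHP w) ((w + conj w) / (1 - ζ) ^ 2) ζ := by
  have h := one_sub_ne_zero_of_mem_ball hζ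
  have h1 : HasDerivAt (fun ζ : ℂ => w + conj w * ζ) (conj w) ζ := by
    simpa using ((hasDerivAt_id ζ).const_mul (conj w)).const_add w
  have h2 : HasDerivAt (fun ζ : ℂ => 1 - ζ) (-1) ζ := (hasDerivAt_id ζ).const_sub 1
  refine (h1.div h2 h).congr_deriv ?_
  congr 1
  ring

theorem re_discToRHP (w ζ : ℂ) :
    (discToRHP w ζ).re = w.re * (1 - ‖ζ‖ ^ 2) / ‖1 - ζ‖ ^ 2 := by
  rw [discToRHP, Complex.div_re, ← Complex.normSq_eq_norm_sq, ← Complex.normSq_eq_norm_sq,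
    ← add_div]
  congr 1
  simp [Complex.normSq_apply]
  ring

theorem discToRHP_injOn {w : ℂ} (hw : 0 < w.re) :
    Set.InjOn (discToRHP w) (Metric.ball (0 : ℂ) 1) := by
  intro a ha b hb h
  have h1 := discToRHP_add_conj w ha
  rw [h, discToRHP_add_conj w hb, div_eq_div_iff (one_sub_ne_zero_of_mem_ball hb)
    (one_sub_ne_zero_of_mem_ball ha)] at h1
  have := mul_left_cancel₀ (add_conj_ne_zero hw hw) h1
  linear_combination -this

theorem image_discToRHP {w : ℂ} (hw : 0 < w.re) :
    discToRHP w '' Metric.ball (0 : ℂ) 1 = {z : ℂ | 0 < z.re} := by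
  ext z
  constructor
  · rintro ⟨ζ, hζ, rfl⟩
    have h1 := norm_pos_iff.2 (one_sub_ne_zero_of_mem_ball hζ)
    rw [Set.mem_ofPred_eq, re_discToRHP w ζ]
    have : 0 < 1 - ‖ζ‖ ^ 2 := by
      rw [mem_ball_zero_iff] at hζ
      nlinarith [norm_nonneg ζ]
    positivity
  · intro hz
    have hz : 0 < z.re := hz
    have h0 := add_conj_ne_zero hz hw
    have hw0 := add_conj_ne_zero hw hw
    refine ⟨(z - w) / (z + conj w), ?_, ?_⟩
    · rw [mem_ball_zero_iff, norm_div, div_lt_one (norm_pos_iff.2 h0)]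
      -- The squares satisfy `|z + conj w|² - |z - w|² = 4 Re z Re w > 0`.
      refine lt_of_pow_lt_pow_left₀ 2 (norm_nonneg _) ?_
      rw [← Complex.normSq_eq_norm_sq, ← Complex.normSq_eq_norm_sq, Complex.normSq_apply,
        Complex.normSq_apply]
      simp
      nlinarith [mul_pos hz hw]
    · have e : 1 - (z - w) / (z + conj w) = (w + conj w) / (z + conj w) := by
        field_simp
        ring
      rw [discToRHP, e]
      field_simp
      ring

/-- This computation dictates the kernel exponent: since `z + conj w = 2 Re w / (1 - ζ)`, two
factors of modulus `|z + conj w|^(-(ℓ+2))` cancel the power of `|1 - ζ|` exactly. -/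
theorem norm_discToRHP_deriv_sq_mul (ℓ : ℕ) {w ζ : ℂ} (hw : 0 < w.re)
    (hζ : ζ ∈ Metric.ball (0 : ℂ) 1) :
    ‖(w + conj w) / (1 - ζ) ^ 2‖ ^ 2 * ((discToRHP w ζ).re ^ ℓ / Real.pi) =
      4 * w.re ^ (ℓ + 2) / Real.pi * (1 - ‖ζ‖ ^ 2) ^ ℓ / ‖1 - ζ‖ ^ (2 * (ℓ + 2)) := by
  have h1 := norm_pos_iff.2 (one_sub_ne_zero_of_mem_ball hζ)
  have e : ‖w + conj w‖ = 2 * w.re := by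
    rw [Complex.add_conj, Complex.norm_real, Real.norm_of_nonneg (by positivity)]
  rw [re_discToRHP w ζ, norm_div, norm_pow, e, div_pow, div_pow, mul_pow w.re]
  have := Real.pi_pos
  field_simp
  ring

/-! ### The reproducing kernel -/

/-- In the disc model the squared kernel times the weight is a constant multiple of `(1 - |ζ|²)^ℓ ≤
1`, on a set of finite area. -/
theorem kernel_mem (ℓ : ℕ) (w : RHP) :
    (fun z : RHP => 1 / ((z : ℂ) + conj (w : ℂ)) ^ (ℓ + 2)) ∈ bergmanSubmodule ℓ := by
  obtain ⟨w, hw⟩ := w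
  have hw : 0 < w.re := hw
  have han : IsAnalytic (fun z : RHP => 1 / ((z : ℂ) + conj w) ^ (ℓ + 2)) := by
    refine ⟨fun z => 1 / (z + conj w) ^ (ℓ + 2), fun z hz => ?_, fun _ => rfl⟩
    have h1 := pow_ne_zero (ℓ + 2) (add_conj_ne_zero hz hw)
    have h2 : DifferentiableAt ℂ (fun z : ℂ => (z + conj w) ^ (ℓ + 2)) z := by fun_prop
    exact ((differentiableAt_const 1).div h2 h1).differentiableWithinAt
  refine ⟨han, han.continuous.aestronglyMeasurable, ?_⟩
  rw [eLpNorm_lt_top_iff_lintegral_rpow_enorm_lt_top (by norm_num) (by norm_num)]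
  simp only [ENNReal.toReal_ofNat, ENNReal.rpow_ofNat]
  rw [lintegral_bergmanMeasure ℓ
    (U := fun z => ‖1 / (z + conj w) ^ (ℓ + 2)‖ₑ ^ 2) (fun _ => rfl), ← image_discToRHP hw,
    lintegral_image_eq_lintegral_normSq_deriv_mul Metric.isOpen_ball.measurableSet
      (fun ζ hζ => hasDerivAt_discToRHP w hζ) (discToRHP_injOn hw)]
  refine lt_of_le_of_lt (setLIntegral_mono' (g := fun _ => ENNReal.ofReal
    (4 * w.re ^ (ℓ + 2) / Real.pi / (2 * w.re) ^ (2 * (ℓ + 2)))) Metric.isOpen_ball.measurableSet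
    fun ζ hζ => ?_) ?_
  · have h1 := norm_pos_iff.2 (one_sub_ne_zero_of_mem_ball hζ)
    have e : ‖w + conj w‖ = 2 * w.re := by
      rw [Complex.add_conj, Complex.norm_real, Real.norm_of_nonneg (by positivity)]
    have hz := mem_ball_zero_iff.1 hζ
    have hb : (1 - ‖ζ‖ ^ 2) ^ ℓ ≤ 1 :=
      pow_le_one₀ (by nlinarith [norm_nonneg ζ]) (by nlinarith [norm_nonneg ζ])
    rw [discToRHP_add_conj w hζ, ← mul_assoc, ← ENNReal.ofReal_mul (by positivity),
      norm_discToRHP_deriv_sq_mul ℓ hw hζ, ← ofReal_norm, ← ENNReal.ofReal_pow (norm_nonneg _),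
      ← ENNReal.ofReal_mul' (by positivity), norm_div, norm_pow, norm_div, e, norm_one]
    refine ENNReal.ofReal_le_ofReal ?_
    have hpi := Real.pi_pos
    have : 4 * w.re ^ (ℓ + 2) / Real.pi * (1 - ‖ζ‖ ^ 2) ^ ℓ / ‖1 - ζ‖ ^ (2 * (ℓ + 2)) *
        (1 / (2 * w.re / ‖1 - ζ‖) ^ (ℓ + 2)) ^ 2 =
        4 * w.re ^ (ℓ + 2) / Real.pi / (2 * w.re) ^ (2 * (ℓ + 2)) * (1 - ‖ζ‖ ^ 2) ^ ℓ := by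
      rw [div_pow (2 * w.re) ‖1 - ζ‖, pow_mul', pow_mul']
      field_simp
    rw [this]
    exact mul_le_of_le_one_right (by positivity) hb
  · rw [setLIntegral_const]
    exact ENNReal.mul_lt_top ENNReal.ofReal_lt_top measure_ball_lt_top

namespace BergmanSpace

variable {ℓ : ℕ}

/-- The function `z ↦ (z + conj w) ^ (-(ℓ + 2))`, up to a constant factor the reproducing kernel
of the Bergman space at `w`. -/
noncomputable def kernel (ℓ : ℕ) (w : RHP) : BergmanSpace ℓ := mk _ (kernel_mem ℓ w)

theorem kernel_apply (w z : RHP) :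
    kernel ℓ w z = 1 / ((z : ℂ) + conj (w : ℂ)) ^ (ℓ + 2) := rfl

/-- The reproducing property. -/
theorem inner_kernel_left (w : RHP) (h : BergmanSpace ℓ) :
    inner ℂ (kernel ℓ w) h = ((1 / (2 ^ ℓ * (ℓ + 1)) : ℝ) : ℂ) * h w := by
  obtain ⟨H, hH, hHh⟩ := h.isAnalytic
  have hint : Integrable (fun z : RHP => h z * conj (kernel ℓ w z)) (bergmanMeasure ℓ) := by
    have := h.memLp.integrable_mul (kernel ℓ w).memLp.star
    exact this
  rw [inner_eq_integral]
  obtain ⟨w, hw⟩ := w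
  change 0 < w.re at hw
  have hU : ∀ z : RHP, H z * conj (1 / ((z : ℂ) + conj w) ^ (ℓ + 2)) =
      h z * conj (kernel ℓ ⟨w, hw⟩ z) := fun z => by
    simp only [hHh, kernel_apply]
  rw [integrable_bergmanMeasure_iff ℓ
    (U := fun z => H z * conj (1 / (z + conj w) ^ (ℓ + 2))) hU, ← image_discToRHP hw,
    integrableOn_image_iff_integrableOn_normSq_deriv_smul Metric.isOpen_ball.measurableSet
      (fun ζ hζ => hasDerivAt_discToRHP w hζ) (discToRHP_injOn hw)] at hint
  rw [integral_bergmanMeasure ℓ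
    (U := fun z => H z * conj (1 / (z + conj w) ^ (ℓ + 2))) hU, ← hHh ⟨w, hw⟩]
  change _ = _ * H w
  rw [← image_discToRHP hw, integral_image_eq_integral_normSq_deriv_smul Metric.isOpen_ball.measurableSet
      (fun ζ hζ => hasDerivAt_discToRHP w hζ) (discToRHP_injOn hw)]
  have hpi := Real.pi_pos
  -- The powers of `Re w` cancel, so `c = 1 / (2 ^ ℓ π)`; multiplied by `π / (ℓ + 1)` from the mean
  -- value property, it gives the stated constant.
  set c : ℝ := 4 * w.re ^ (ℓ + 2) / Real.pi / (2 * w.re) ^ (ℓ + 2) with hc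
  have hc0 : c ≠ 0 := by positivity
  -- The conjugated kernel cancels the antiholomorphic half of `|1 - ζ|^(2(ℓ+2))`. What remains
  -- besides the radial weight is holomorphic, with value `H w` at `0`.
  have hpt : ∀ ζ ∈ Metric.ball (0 : ℂ) 1, ‖(w + conj w) / (1 - ζ) ^ 2‖ ^ 2 •
      ((discToRHP w ζ).re ^ ℓ / Real.pi) • (H (discToRHP w ζ) *
        conj (1 / (discToRHP w ζ + conj w) ^ (ℓ + 2))) =
      c • ((1 - ‖ζ‖ ^ 2) ^ ℓ • (H (discToRHP w ζ) / (1 - ζ) ^ (ℓ + 2))) := by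
    intro ζ hζ
    have h1 := one_sub_ne_zero_of_mem_ball hζ
    have h2 : conj (1 - ζ) ≠ 0 := (map_ne_zero _).2 h1
    have h3 : (w.re : ℂ) ≠ 0 := by exact_mod_cast hw.ne'
    have h4 : (Real.pi : ℂ) ≠ 0 := by exact_mod_cast hpi.ne'
    have h5 : ((‖1 - ζ‖ : ℝ) : ℂ) ^ (2 * (ℓ + 2)) =
        (1 - ζ) ^ (ℓ + 2) * conj (1 - ζ) ^ (ℓ + 2) := by
      rw [pow_mul, ← mul_pow, Complex.mul_conj, Complex.normSq_eq_norm_sq]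
      push_cast
      rfl
    rw [smul_smul, norm_discToRHP_deriv_sq_mul ℓ hw hζ, discToRHP_add_conj w hζ,
      Complex.add_conj, smul_smul]
    simp only [Complex.real_smul, hc, map_div₀, map_pow, map_one, Complex.conj_ofReal]
    push_cast
    rw [h5, div_pow _ (conj (1 - ζ))]
    field_simp
  rw [integrableOn_congr_fun hpt Metric.isOpen_ball.measurableSet] at hint
  rw [setIntegral_congr_fun Metric.isOpen_ball.measurableSet hpt, integral_smul,
    integral_ball_weight_smul]
  · simp only [sub_zero, one_pow, div_one]
    have : discToRHP w 0 = w := by simp [discToRHP]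
    rw [this, smul_smul, Complex.real_smul]
    congr 2
    rw [hc]
    field_simp
    ring
  · intro ζ hζ
    have h1 := pow_ne_zero (ℓ + 2) (one_sub_ne_zero_of_mem_ball hζ)
    have h2 : discToRHP w ζ ∈ {z : ℂ | 0 < z.re} :=
      image_discToRHP hw ▸ Set.mem_image_of_mem _ hζ
    have h3 : DifferentiableAt ℂ H (discToRHP w ζ) := hH.differentiableAt (isOpen_rhp.mem_nhds h2)
    have h4 := h3.comp ζ (hasDerivAt_discToRHP w hζ).differentiableAt
    have h5 : DifferentiableAt ℂ (fun ζ : ℂ => (1 - ζ) ^ (ℓ + 2)) ζ := by fun_prop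
    exact (h4.div h5 h1).differentiableWithinAt
  · exact (integrable_smul_iff hc0 _).1 hint

end BergmanSpace

/-! ### Kernel identity and point evaluations -/

/-- The kernel identity: `f z * K_w (g z)` is hermitian in `(z, w)`. -/
def HermitianKernelIdentity (n : ℕ) (f : RHP → ℂ) (g : RHP → RHP) : Prop :=
  ∀ z w : RHP, f z * ((z : ℂ) + conj (g w : ℂ)) ^ n = conj (f w) * ((g z : ℂ) + conj (w : ℂ)) ^ n

namespace BergmanSpace

variable {ℓ : ℕ}

theorem inner_kernel_right (w : RHP) (h : BergmanSpace ℓ) :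
    inner ℂ h (kernel ℓ w) = ((1 / (2 ^ ℓ * (ℓ + 1)) : ℝ) : ℂ) * conj (h w) := by
  rw [← inner_conj_symm, inner_kernel_left, map_mul, Complex.conj_ofReal]

theorem kernel_factor_ne_zero (ℓ : ℕ) : ((1 / (2 ^ ℓ * (ℓ + 1)) : ℝ) : ℂ) ≠ 0 := by
  have : (1 / (2 ^ ℓ * (ℓ + 1)) : ℝ) ≠ 0 := by positivity
  exact_mod_cast this

/-- Point evaluations are bounded. -/
theorem norm_apply_le (w : RHP) (h : BergmanSpace ℓ) :
    ‖h w‖ ≤ (2 ^ ℓ * (ℓ + 1)) * ‖kernel ℓ w‖ * ‖h‖ := by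
  have h1 := norm_inner_le_norm (𝕜 := ℂ) (kernel ℓ w) h
  rw [inner_kernel_left, norm_mul, Complex.norm_real, Real.norm_of_nonneg (by positivity),
    one_div, inv_mul_le_iff₀ (by positivity)] at h1
  linarith

theorem ofReal_norm_sq (h : BergmanSpace ℓ) :
    ENNReal.ofReal (‖h‖ ^ 2) = ∫⁻ z, ‖h z‖ₑ ^ 2 ∂(bergmanMeasure ℓ) := by
  have h2 := eLpNorm_nnreal_pow_eq_lintegral (μ := bergmanMeasure ℓ) (f := h.toFun)
    (p := 2) (by norm_num)
  have h3 : ENNReal.ofReal ‖h‖ = eLpNorm h.toFun 2 (bergmanMeasure ℓ) := by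
    rw [← norm_toLp, toLp, Lp.norm_toLp, ENNReal.ofReal_toReal h.memLp.2.ne]
  rw [ENNReal.ofReal_pow (norm_nonneg _), h3]
  simpa using h2

end BergmanSpace

open BergmanSpace

/-! ### Boundedness criteria -/

theorem IsAnalytic.weightedComp {f h : RHP → ℂ} {g : RHP → RHP} (hf : IsAnalytic f)
    (hg : IsAnalytic fun z => (g z : ℂ)) (hh : IsAnalytic h) :
    IsAnalytic (weightedComp f g h) := by
  obtain ⟨F, hF, hFf⟩ := hf
  obtain ⟨G, hG, hGg⟩ := hg
  obtain ⟨H, hH, hHh⟩ := hh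
  refine ⟨fun z => F z * H (G z), hF.mul (hH.comp hG fun z hz => ?_), fun z => ?_⟩
  · rw [hGg ⟨z, hz⟩]
    exact (g ⟨z, hz⟩).2
  · simp only [hFf, hGg, hHh, _root_.weightedComp]

theorem IsBoundedOperator.of_lintegral_le {ℓ : ℕ} {f : RHP → ℂ} {g : RHP → RHP}
    (hf : IsAnalytic f) (hg : IsAnalytic fun z => (g z : ℂ)) (C : ℝ) (hC : 0 ≤ C)
    (hbound : ∀ h : BergmanSpace ℓ, ∫⁻ z, ‖weightedComp f g h z‖ₑ ^ 2 ∂(bergmanMeasure ℓ) ≤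
      ENNReal.ofReal (C * ‖h‖ ^ 2)) :
    IsBoundedOperator (maxWeightedComp ℓ f g) := by
  have hmem : ∀ h : BergmanSpace ℓ, weightedComp f g h ∈ bergmanSubmodule ℓ := fun h => by
    have han := hf.weightedComp hg h.isAnalytic
    refine ⟨han, han.continuous.aestronglyMeasurable, ?_⟩
    rw [eLpNorm_lt_top_iff_lintegral_rpow_enorm_lt_top (by norm_num) (by norm_num)]
    simp only [ENNReal.toReal_ofNat, ENNReal.rpow_ofNat]
    exact (hbound h).trans_lt ENNReal.ofReal_lt_top
  -- The summand `1` keeps the bound positive when `C = 0`.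
  refine ⟨Submodule.eq_top_iff'.2 hmem, √C + 1, by positivity, fun h => ?_⟩
  have h1 := hbound h
  have h2 := ofReal_norm_sq (maxWeightedComp ℓ f g h)
  have h3 : ∫⁻ z, ‖maxWeightedComp ℓ f g h z‖ₑ ^ 2 ∂(bergmanMeasure ℓ) =
    ∫⁻ z, ‖weightedComp f g (h : BergmanSpace ℓ) z‖ₑ ^ 2 ∂(bergmanMeasure ℓ) := rfl
  rw [← h3, ← h2, ENNReal.ofReal_le_ofReal_iff (by positivity)] at h1
  have h4 : ‖maxWeightedComp ℓ f g h‖ ≤ √C * ‖(h : BergmanSpace ℓ)‖ := by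
    refine abs_le_of_sq_le_sq' ?_ (by positivity) |>.2
    rwa [mul_pow, Real.sq_sqrt hC]
  linarith [norm_nonneg (h : BergmanSpace ℓ)]

/-- A weighted composition operator with injective symbol is bounded if its weight is controlled
by the Jacobian of the symbol. -/
theorem IsBoundedOperator.of_injOn {ℓ : ℕ} {f : RHP → ℂ} {g : RHP → RHP}
    (hf : IsAnalytic f) (hg : IsAnalytic fun z => (g z : ℂ)) {G G' : ℂ → ℂ}
    (hGg : ∀ z : RHP, G z = g z) (hG : ∀ z : ℂ, 0 < z.re → HasDerivAt G (G' z) z)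
    (hinj : Set.InjOn G {z : ℂ | 0 < z.re}) (C : ℝ) (hC : 0 ≤ C)
    (hbound : ∀ z : RHP, ‖f z‖ ^ 2 * (z : ℂ).re ^ ℓ ≤ C * (‖G' z‖ ^ 2 * (g z : ℂ).re ^ ℓ)) :
    IsBoundedOperator (maxWeightedComp ℓ f g) := by
  refine .of_lintegral_le hf hg C hC fun h => ?_
  obtain ⟨F, hF, hFf⟩ := hf
  obtain ⟨H, hH, hHh⟩ := h.isAnalytic
  have hpi := Real.pi_pos
  rw [ENNReal.ofReal_mul hC, ofReal_norm_sq,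
    lintegral_bergmanMeasure ℓ (U := fun z => ‖F z * H (G z)‖ₑ ^ 2) fun z => by
      simp only [hHh, hGg, hFf, weightedComp],
    lintegral_bergmanMeasure ℓ (U := fun z => ‖H z‖ₑ ^ 2) fun z => by simp only [hHh]]
  have himg : G '' {z : ℂ | 0 < z.re} ⊆ {z : ℂ | 0 < z.re} := by
    rintro _ ⟨z, hz, rfl⟩
    rw [hGg ⟨z, hz⟩]
    exact (g ⟨z, hz⟩).2
  -- The norm of `h` is only needed over the image of `G`; pulled back along `G`, that integral can
  -- be compared pointwise.
  refine le_trans ?_ (mul_le_mul_right (lintegral_mono_set himg) _)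
  rw [lintegral_image_eq_lintegral_normSq_deriv_mul isOpen_rhp.measurableSet hG hinj,
    ← lintegral_const_mul' _ _ ENNReal.ofReal_ne_top]
  refine setLIntegral_mono' isOpen_rhp.measurableSet fun z hz => ?_
  have hz' : 0 < z.re := hz
  have hb := hbound ⟨z, hz⟩
  rw [← hGg, ← hFf] at hb
  have hGz : 0 < (G z).re := himg (Set.mem_image_of_mem G hz)
  rw [enorm_mul, mul_pow, ← mul_assoc, ← mul_assoc, ← mul_assoc]
  refine mul_le_mul_left ?_ _
  rw [← ofReal_norm, ← ENNReal.ofReal_pow (norm_nonneg _), ← ENNReal.ofReal_mul (by positivity),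
    ← ENNReal.ofReal_mul hC, ← ENNReal.ofReal_mul (by positivity)]
  refine ENNReal.ofReal_le_ofReal ?_
  calc z.re ^ ℓ / Real.pi * ‖F z‖ ^ 2 = ‖F z‖ ^ 2 * z.re ^ ℓ / Real.pi := by ring
    _ ≤ C * (‖G' z‖ ^ 2 * (G z).re ^ ℓ) / Real.pi := by gcongr
    _ = _ := by ring

/-! ### Self-adjointness and the kernel identity -/

theorem weightedComp_kernel_eq {ℓ : ℕ} {f : RHP → ℂ} {g : RHP → RHP}
    (hk : HermitianKernelIdentity (ℓ + 2) f g) (w : RHP) :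
    weightedComp f g (kernel ℓ w) = (conj (f w) • kernel ℓ (g w) : BergmanSpace ℓ) := by
  funext z
  have h1 := hk z w
  have h2 := pow_ne_zero (ℓ + 2) (add_conj_ne_zero (g z).2 w.2)
  have h3 := pow_ne_zero (ℓ + 2) (add_conj_ne_zero z.2 (g w).2)
  rw [weightedComp, smul_apply, kernel_apply, kernel_apply, mul_one_div, mul_one_div,
    div_eq_div_iff h2 h3, h1]

/-- Boundedness makes the adjoint everywhere defined. Pairing with `K_w` and using the action on
kernels gives `(W* y)(w) = f w * y (g w)`, the formula of the operator itself. -/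
theorem IsBoundedOperator.isSelfAdjoint {ℓ : ℕ} {f : RHP → ℂ} {g : RHP → RHP}
    (hb : IsBoundedOperator (maxWeightedComp ℓ f g))
    (hk : HermitianKernelIdentity (ℓ + 2) f g) :
    IsSelfAdjoint (maxWeightedComp ℓ f g) := by
  obtain ⟨htop, L, -, hL⟩ := hb
  have hdense : Dense ((maxWeightedComp ℓ f g).domain : Set (BergmanSpace ℓ)) := by
    rw [htop]
    exact dense_univ
  have hadj : ∀ y : BergmanSpace ℓ, y ∈ (maxWeightedComp ℓ f g).adjoint.domain := fun y => by
    rw [LinearPMap.mem_adjoint_domain_iff]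
    exact (innerSL ℂ y).continuous.comp
      (AddMonoidHomClass.continuous_of_bound (maxWeightedComp ℓ f g).toFun L hL)
  have hle : maxWeightedComp ℓ f g ≤ (maxWeightedComp ℓ f g).adjoint := by
    refine ⟨fun y _ => hadj y, fun x y hxy => BergmanSpace.ext fun w => ?_⟩
    have hkd : kernel ℓ w ∈ (maxWeightedComp ℓ f g).domain := by rw [htop]; trivial
    have hkw : maxWeightedComp ℓ f g ⟨kernel ℓ w, hkd⟩ = conj (f w) • kernel ℓ (g w) :=
      BergmanSpace.ext fun z => congrFun (weightedComp_kernel_eq hk w) z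
    have h1 := LinearPMap.adjoint_isFormalAdjoint hdense y ⟨kernel ℓ w, hkd⟩
    rw [hkw, inner_kernel_right, inner_smul_right, inner_kernel_right, mul_left_comm] at h1
    have h2 := congrArg conj (mul_left_cancel₀ (kernel_factor_ne_zero ℓ) h1)
    rw [map_mul, Complex.conj_conj, Complex.conj_conj, Complex.conj_conj, ← hxy] at h2
    rw [h2, maxWeightedComp_apply]
  exact (LinearPMap.eq_of_le_of_domain_eq hle
    (by rw [htop]; exact (Submodule.eq_top_iff'.2 hadj).symm)).symm

/-- A self-adjoint restriction of a maximal weighted composition operator acts on kernels by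
`K_w ↦ conj (f w) • K_{g w}`. -/
theorem HermitianKernelIdentity.of_isSelfAdjoint {ℓ : ℕ} {f : RHP → ℂ} {g : RHP → RHP}
    {W : BergmanSpace ℓ →ₗ.[ℂ] BergmanSpace ℓ} (hW : W ≤ maxWeightedComp ℓ f g)
    (hsa : IsSelfAdjoint W) : HermitianKernelIdentity (ℓ + 2) f g := by
  intro z w
  have hdense := hsa.dense_domain
  have hsa' : W.adjoint = W := hsa
  have hval : ∀ (x : W.domain) (v : RHP), W x v = f v * (x : BergmanSpace ℓ) (g v) := fun x v => by
    rw [hW.2 (y := ⟨x, hW.1 x.2⟩) rfl]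
    rfl
  have hinner : ∀ x : W.domain, inner ℂ (conj (f w) • kernel ℓ (g w)) (x : BergmanSpace ℓ) =
      inner ℂ (kernel ℓ w) (W x) := fun x => by
    rw [inner_smul_left, inner_kernel_left, inner_kernel_left, hval, Complex.conj_conj]
    ring
  -- The adjoint is used first because membership of the kernel in the domain of `W` is not known
  -- beforehand; it follows from `W* = W`.
  have hdom : kernel ℓ w ∈ W.adjoint.domain :=
    LinearPMap.mem_adjoint_domain_of_exists _ ⟨_, hinner⟩
  have h1 := LinearPMap.adjoint_apply_eq hdense ⟨kernel ℓ w, hdom⟩ hinner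
  have hdom' : kernel ℓ w ∈ W.domain := hsa' ▸ hdom
  have h2 : W ⟨kernel ℓ w, hdom'⟩ = conj (f w) • kernel ℓ (g w) := by
    rw [← h1]
    exact (hsa'.le.2 (x := ⟨kernel ℓ w, hdom⟩) (y := ⟨kernel ℓ w, hdom'⟩) rfl).symm
  have h3 := hval ⟨kernel ℓ w, hdom'⟩ z
  have h4 := pow_ne_zero (ℓ + 2) (add_conj_ne_zero (g z).2 w.2)
  have h5 := pow_ne_zero (ℓ + 2) (add_conj_ne_zero z.2 (g w).2)
  rw [h2, smul_apply, kernel_apply, kernel_apply, mul_one_div, mul_one_div,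
    div_eq_div_iff h5 h4] at h3
  exact h3.symm

/-- Self-adjoint operators are maximal among the self-adjoint ones. -/
theorem eq_of_le_of_isSelfAdjoint {E : Type*} [NormedAddCommGroup E] [InnerProductSpace ℂ E]
    [CompleteSpace E] {S T : E →ₗ.[ℂ] E} (hle : S ≤ T) (hS : IsSelfAdjoint S)
    (hT : IsSelfAdjoint T) : S = T := by
  refine le_antisymm hle ?_
  have hS' : S.adjoint = S := hS
  have hT' : T.adjoint = T := hT
  have h := LinearPMap.adjoint_isFormalAdjoint hT.dense_domain
  rw [hT'] at h
  have h2 : S.IsFormalAdjoint T := fun x y => by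
    rw [hle.2 (y := ⟨x, hle.1 x.2⟩) rfl]
    exact h ⟨x, hle.1 x.2⟩ y
  exact (h2.le_adjoint hS.dense_domain).trans hS'.le

/-! ### Solving the kernel identity -/

/-- The logarithmic derivative of an identity `F * P ^ n = c * Q ^ n`, without denominators. -/
theorem mul_deriv_eq_of_mul_pow_eventuallyEq {F P Q : ℂ → ℂ} {F' P' Q' z c : ℂ} (k : ℕ)
    (hF : HasDerivAt F F' z) (hP : HasDerivAt P P' z) (hQ : HasDerivAt Q Q' z)
    (h : ∀ᶠ x in 𝓝 z, F x * P x ^ (k + 1) = c * Q x ^ (k + 1)) (hz : P z ≠ 0) :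
    Q z * (F' * P z + (k + 1) * F z * P') = (k + 1) * F z * P z * Q' := by
  have h1 := (hF.mul (hP.pow (k + 1))).congr_of_eventuallyEq
    (show (fun x => c * Q x ^ (k + 1)) =ᶠ[𝓝 z] _ from h.mono fun _ hx => hx.symm)
  have h2 := h1.unique ((hQ.pow (k + 1)).const_mul c)
  have h3 := h.self_of_nhds
  simp only [Pi.pow_apply, Nat.add_sub_cancel, Nat.cast_add, Nat.cast_one] at h2
  -- Multiplying the differentiated identity by `Q z` lets `c * Q ^ (k + 1)` be replaced by `F * P ^
  -- (k + 1)`; then `P ^ k` cancels, with no division by `Q`.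
  refine mul_left_cancel₀ (pow_ne_zero k hz) ?_
  linear_combination Q z * h2 - (k + 1) * Q' * h3

theorem rhp_one : (0 : ℝ) < (1 : ℂ).re := by simp

/-- The sums raised to the power `n` have positive real part, so one zero of `f` would propagate to
every point. -/
theorem HermitianKernelIdentity.ne_zero {n : ℕ} {f : RHP → ℂ} {g : RHP → RHP}
    (hk : HermitianKernelIdentity n f g) (hne : ¬ ∀ z, f z = 0) (z : RHP) : f z ≠ 0 := by
  obtain ⟨w, hw⟩ := not_forall.1 hne
  intro hz
  have h := hk w z
  rw [hz, map_zero, zero_mul] at h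
  exact mul_ne_zero hw (pow_ne_zero n (add_conj_ne_zero w.2 (g z).2)) h

/-- The symbol `g` of a solution of the kernel identity is linear fractional, and the weight `f`
is a power of the reciprocal of its denominator. -/
theorem HermitianKernelIdentity.exists_linearFractional {k : ℕ} {f : RHP → ℂ} {g : RHP → RHP}
    (hk : HermitianKernelIdentity (k + 1) f g) (hf : IsAnalytic f)
    (hg : IsAnalytic fun z => (g z : ℂ)) (hne : ¬ ∀ z, f z = 0) :
    ∃ A m B F₀ : ℂ, F₀ ≠ 0 ∧ ∀ w : RHP, A - m * w ≠ 0 ∧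
      (1 + (g w : ℂ)) * (A - m * w) = B + w ∧ f w * (A - m * w) ^ (k + 1) = F₀ := by
  have hk' := hk
  have hf0 := hk.ne_zero hne ⟨1, rhp_one⟩
  obtain ⟨F, hF, hFf⟩ := hf
  obtain ⟨G, hG, hGg⟩ := hg
  have hnhds := isOpen_rhp.mem_nhds rhp_one
  have hF1 := (hF.differentiableAt hnhds).hasDerivAt
  have hG1 := (hG.differentiableAt hnhds).hasDerivAt
  have hF0 : F 1 ≠ 0 := by rw [hFf ⟨1, rhp_one⟩]; exact hf0
  have hG0 : 0 < (G 1).re := by rw [hGg ⟨1, rhp_one⟩]; exact (g ⟨1, rhp_one⟩).2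
  have hk1 : (k : ℂ) + 1 ≠ 0 := by exact_mod_cast k.succ_ne_zero
  -- The logarithmic derivative of `f` at `1`, divided by the exponent; `h2` below is then an
  -- equation affine in `conj w` and linear in `1 + conj (g w)`, to be conjugated.
  set φ := deriv F 1 / ((k + 1) * F 1) with hφ
  refine ⟨conj (deriv G 1 - φ * G 1), conj φ, conj (G 1), conj (F 1), (map_ne_zero _).2 hF0,
    fun w => ?_⟩
  have hq : 1 + conj (g w : ℂ) ≠ 0 := add_conj_ne_zero rhp_one (g w).2
  have hev : ∀ᶠ z in 𝓝 (1 : ℂ), F z * (z + conj (g w : ℂ)) ^ (k + 1) =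
      conj (f w) * (G z + conj (w : ℂ)) ^ (k + 1) := by
    filter_upwards [hnhds] with z hz
    rw [hFf ⟨z, hz⟩, hGg ⟨z, hz⟩]
    exact hk ⟨z, hz⟩ w
  have h1 := mul_deriv_eq_of_mul_pow_eventuallyEq k hF1
    ((hasDerivAt_id (1 : ℂ)).add_const (conj (g w : ℂ))) (hG1.add_const (conj (w : ℂ))) hev hq
  have hv : G 1 + conj (w : ℂ) ≠ 0 := add_conj_ne_zero hG0 w.2
  have h2 : (1 + conj (g w : ℂ)) * (deriv G 1 - φ * G 1 - φ * conj (w : ℂ)) =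
      G 1 + conj (w : ℂ) := by
    have hd : deriv F 1 = φ * ((k + 1) * F 1) := by rw [hφ]; field_simp
    rw [hd] at h1
    simp only [id_eq] at h1
    refine mul_left_cancel₀ (mul_ne_zero hk1 hF0) ?_
    linear_combination -h1
  have hu : deriv G 1 - φ * G 1 - φ * conj (w : ℂ) ≠ 0 := fun h => hv (by rw [← h2, h, mul_zero])
  have hu' : conj (deriv G 1 - φ * G 1) - conj φ * (w : ℂ) =
      conj (deriv G 1 - φ * G 1 - φ * conj (w : ℂ)) := by simp
  rw [hu']
  refine ⟨(map_ne_zero _).2 hu, ?_, ?_⟩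
  · have := congrArg conj h2
    simpa using this
  -- At `z = 1` the relation `h2` exhibits `(1 + conj (g w)) ^ (k + 1)` as a common factor;
  -- cancelling it determines `f w`.
  · have h3 := hev.self_of_nhds
    rw [← h2, mul_pow, mul_comm (_ ^ _) (_ ^ _), ← mul_assoc] at h3
    have h4 := congrArg conj (mul_right_cancel₀ (pow_ne_zero _ hq) h3)
    rw [map_mul, Complex.conj_conj, map_pow] at h4
    exact h4.symm

/-- The logarithmic derivative gives `|κ| = 1` and `τ = κ * conj τ`. Preservation of the half-plane
then leaves only `κ = 1` and a real `τ ≥ 0`. -/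
theorem HermitianKernelIdentity.translation_of_affine {k : ℕ} {f : RHP → ℂ} {g : RHP → RHP}
    (hk : HermitianKernelIdentity (k + 1) f g) {κ τ c : ℂ} (hc : c ≠ 0)
    (h : ∀ w : RHP, (g w : ℂ) = κ * w + τ ∧ f w = c) : HermitianFamilyTranslation f g := by
  have hk1 : (k : ℂ) + 1 ≠ 0 := by exact_mod_cast k.succ_ne_zero
  have hpos : ∀ w : ℂ, 0 < w.re → 0 < (κ * w + τ).re := fun w hw => by
    rw [← (h ⟨w, hw⟩).1]; exact (g ⟨w, hw⟩).2
  have key : ∀ w : RHP, τ + conj (w : ℂ) = κ * conj κ * conj (w : ℂ) + κ * conj τ := by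
    intro w
    have hq : 1 + conj (g w : ℂ) ≠ 0 := add_conj_ne_zero rhp_one (g w).2
    have hev : ∀ᶠ z in 𝓝 (1 : ℂ), c * (z + conj (g w : ℂ)) ^ (k + 1) =
        conj c * ((κ * z + τ) + conj (w : ℂ)) ^ (k + 1) := by
      filter_upwards [isOpen_rhp.mem_nhds rhp_one] with z hz
      have h1 := hk ⟨z, hz⟩ w
      rwa [(h ⟨z, hz⟩).1, (h ⟨z, hz⟩).2, (h w).2] at h1
    have h1 := mul_deriv_eq_of_mul_pow_eventuallyEq k (hasDerivAt_const (1 : ℂ) c)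
      ((hasDerivAt_id (1 : ℂ)).add_const (conj (g w : ℂ)))
      ((((hasDerivAt_id (1 : ℂ)).const_mul κ).add_const τ).add_const (conj (w : ℂ))) hev hq
    rw [(h w).1] at h1
    simp only [id_eq, map_add, map_mul] at h1
    refine mul_left_cancel₀ (mul_ne_zero hk1 hc) ?_
    linear_combination h1
  have k1 := key ⟨1, by simp⟩
  have k2 := key ⟨2, by simp⟩
  simp only [map_one, map_ofNat] at k1 k2
  have hκ : κ * conj κ = 1 := by linear_combination k1 - k2
  have hτ : τ = κ * conj τ := by linear_combination 2 * k1 - k2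
  have him : κ.im = 0 := by
    by_contra hne
    -- This point of the line `Re z = 1` is sent to the imaginary axis.
    have := hpos (1 + ((κ.re + τ.re) / κ.im : ℝ) * Complex.I) (by simp)
    simp [-Complex.ofReal_div, -Complex.ofReal_add] at this
    have e : κ.im * ((κ.re + τ.re) / κ.im) = κ.re + τ.re := by field_simp
    linarith
  have hre2 : κ.re * κ.re = 1 := by
    have := congrArg Complex.re hκ
    simp [him] at this
    nlinarith
  have hre : κ.re = 1 := by
    rcases mul_self_eq_one_iff.1 hre2 with h | h
    · exact h
    · exfalso
      have := hpos ((|τ.re| + 1 : ℝ) : ℂ) (by simp; positivity)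
      simp [h, him, -Complex.ofReal_add] at this
      linarith [le_abs_self τ.re]
  have hκ1 : κ = 1 := Complex.ext (by simpa using hre) (by simpa using him)
  rw [hκ1, one_mul] at hτ
  obtain ⟨γ, rfl⟩ := Complex.conj_eq_iff_real.1 hτ.symm
  have hγ : 0 ≤ γ := by
    by_contra hneg
    have := hpos ((-γ : ℝ) : ℂ) (by simpa using hneg)
    simp [hκ1] at this
  have hcr : conj c = c := by
    -- On the diagonal both powers have the same base `2 + γ`, so `c` equals its conjugate.
    have h1 := hk ⟨1, rhp_one⟩ ⟨1, rhp_one⟩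
    have hq : 1 + conj (g ⟨1, rhp_one⟩ : ℂ) ≠ 0 := add_conj_ne_zero rhp_one (g _).2
    rw [(h _).1, hκ1] at h1 hq
    rw [(h _).2] at h1
    simp only [map_add, map_mul, map_one, Complex.conj_ofReal] at h1 hq
    refine mul_right_cancel₀ (pow_ne_zero (k + 1) hq) ?_
    rw [h1]
    ring
  obtain ⟨c, rfl⟩ := Complex.conj_eq_iff_real.1 hcr
  exact ⟨γ, c, hγ, fun w => ⟨by rw [(h w).1, hκ1, one_mul], (h w).2⟩⟩

/-- The number `P` is the value of `g` at infinity and `A / m` is its pole. The kernel identity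
forces the pole to be `-conj P`, the reflection of `P` in the imaginary axis, and the two remaining
constants to be real. -/
theorem HermitianKernelIdentity.exists_normalForm {k : ℕ} {f : RHP → ℂ} {g : RHP → RHP}
    (hk : HermitianKernelIdentity (k + 1) f g) {A m B F₀ : ℂ} (hm : m ≠ 0) (hF₀ : F₀ ≠ 0)
    (h : ∀ w : RHP, A - m * w ≠ 0 ∧
      (1 + (g w : ℂ)) * (A - m * w) = B + w ∧ f w * (A - m * w) ^ (k + 1) = F₀) :
    ∃ (P : ℂ) (r ε : ℝ), ε ≠ 0 ∧ ∀ w : RHP, (w : ℂ) + conj P ≠ 0 ∧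
      (g w : ℂ) = P - r / (w + conj P) ∧ f w = ε / (w + conj P) ^ (k + 1) := by
  have hk1 : (k : ℂ) + 1 ≠ 0 := by exact_mod_cast k.succ_ne_zero
  have hm' : conj m ≠ 0 := (map_ne_zero _).2 hm
  set P : ℂ := -1 - 1 / m with hP
  set Q : ℂ := B + A / m with hQ
  have hg : ∀ w : RHP, (g w : ℂ) * (A - m * w) = P * (A - m * w) + Q := fun w => by
    have := (h w).2.1
    rw [hP, hQ]
    field_simp
    linear_combination m * this
  -- The logarithmic derivative at `z = 1` after both denominators are cleared: an equality of
  -- polynomials of degree at most two in `conj w`.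
  have key : ∀ w : RHP, (conj A - conj m * conj (w : ℂ)) * (A * (P + conj (w : ℂ)) + Q) =
      -m * (P + conj (w : ℂ)) * ((conj A - conj m * conj (w : ℂ)) * conj P + conj Q) := by
    intro w
    have hu : conj A - conj m * conj (w : ℂ) ≠ 0 := by
      have := (map_ne_zero conj).2 (h w).1
      rwa [map_sub, map_mul] at this
    have hgw := congrArg conj (hg w)
    simp only [map_mul, map_sub, map_add] at hgw
    have hfw := congrArg conj (h w).2.2
    simp only [map_mul, map_sub, map_pow] at hfw
    have hq : (conj A - conj m * conj (w : ℂ)) * (1 + conj P) + conj Q ≠ 0 := by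
      have := mul_ne_zero (add_conj_ne_zero rhp_one (g w).2) hu
      intro h0
      apply this
      rw [add_mul, hgw]
      linear_combination h0
    have hev : ∀ᶠ z in 𝓝 (1 : ℂ),
        F₀ * ((conj A - conj m * conj (w : ℂ)) * (z + conj P) + conj Q) ^ (k + 1) =
        conj F₀ * ((A - m * z) * (P + conj (w : ℂ)) + Q) ^ (k + 1) := by
      filter_upwards [isOpen_rhp.mem_nhds rhp_one] with z hz
      have h1 := hk ⟨z, hz⟩ w
      have h2 := hg ⟨z, hz⟩
      have h3 := (h ⟨z, hz⟩).2.2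
      simp only at h1 h2 h3
      have e1 : (conj A - conj m * conj (w : ℂ)) * (z + conj P) + conj Q =
          (conj A - conj m * conj (w : ℂ)) * (z + conj (g w : ℂ)) := by
        linear_combination -hgw
      have e2 : (A - m * z) * (P + conj (w : ℂ)) + Q =
          (A - m * z) * ((g ⟨z, hz⟩ : ℂ) + conj (w : ℂ)) := by
        linear_combination -h2
      rw [e1, e2, ← hfw, ← h3, mul_pow, mul_pow]
      linear_combination (A - m * z) ^ (k + 1) *
        (conj A - conj m * conj (w : ℂ)) ^ (k + 1) * h1
    have h1 := mul_deriv_eq_of_mul_pow_eventuallyEq k (hasDerivAt_const (1 : ℂ) F₀)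
      ((((hasDerivAt_id (1 : ℂ)).add_const (conj P)).const_mul
        (conj A - conj m * conj (w : ℂ))).add_const (conj Q))
      (((((hasDerivAt_id (1 : ℂ)).const_mul m).const_sub A).mul_const
        (P + conj (w : ℂ))).add_const Q) hev hq
    simp only [id_eq] at h1
    refine mul_left_cancel₀ (mul_ne_zero hk1 hF₀) ?_
    linear_combination h1
  have k1 := key ⟨1, by simp⟩
  have k2 := key ⟨2, by simp⟩
  have k3 := key ⟨3, by simp⟩
  simp only [map_one, map_ofNat] at k1 k2 k3
  have hA : A = -m * conj P := by
    refine mul_left_cancel₀ hm' ?_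
    -- The second difference over `1, 2, 3` isolates the quadratic coefficient.
    linear_combination -(k1 - 2 * k2 + k3) / 2
  have hu : ∀ w : RHP, A - m * w = -m * (w + conj P) := fun w => by rw [hA]; ring
  have hne : ∀ w : RHP, (w : ℂ) + conj P ≠ 0 := fun w h0 => (h w).1 (by rw [hu, h0, mul_zero])
  have hQr : conj m * Q = m * conj Q := by
    have h1 := (map_ne_zero conj).2 (hne ⟨1, rhp_one⟩)
    rw [map_add, Complex.conj_conj, map_one] at h1
    have hA' := congrArg conj hA
    simp only [map_mul, map_neg, Complex.conj_conj] at hA'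
    refine mul_left_cancel₀ h1 ?_
    rw [hA', hA] at k1
    linear_combination -k1
  obtain ⟨r, hr⟩ : ∃ r : ℝ, Q / m = r := by
    refine (Complex.conj_eq_iff_real).1 ?_
    rw [map_div₀, div_eq_div_iff hm' hm]
    linear_combination -hQr
  have hg' : ∀ w : RHP, (g w : ℂ) = P - r / (w + conj P) := fun w => by
    have h1 := hg w
    have h2 := hne w
    rw [hu] at h1
    rw [← hr]
    refine mul_right_cancel₀ (mul_ne_zero (neg_ne_zero.2 hm) h2) (h1.trans ?_)
    field_simp
    ring
  have hf' : ∀ w : RHP, f w = (F₀ / (-m) ^ (k + 1)) / (w + conj P) ^ (k + 1) := fun w => by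
    rw [← (h w).2.2, hu, mul_pow]
    have h2 := pow_ne_zero (k + 1) (hne w)
    have h3 := pow_ne_zero (k + 1) (neg_ne_zero.2 hm)
    field_simp
  set E := F₀ / (-m) ^ (k + 1) with hE
  have hE0 : E ≠ 0 := div_ne_zero hF₀ (pow_ne_zero _ (neg_ne_zero.2 hm))
  have hEr : conj E = E := by
    have h1 := hk ⟨1, rhp_one⟩ ⟨1, rhp_one⟩
    have h2 := hne ⟨1, rhp_one⟩
    have h3 := (map_ne_zero conj).2 h2
    have hq := add_conj_ne_zero rhp_one (g ⟨1, rhp_one⟩).2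
    -- Both sides equal `|1 + P|² - r`, so the kernel identity at `z = w = 1` compares `E` with
    -- `conj E` alone.
    have hq' : (1 + P) * (1 + conj (g ⟨1, rhp_one⟩ : ℂ)) =
        (1 + conj P) * ((g ⟨1, rhp_one⟩ : ℂ) + 1) := by
      rw [hg']
      simp only [map_add, map_sub, map_div₀, map_one, Complex.conj_conj,
        Complex.conj_ofReal] at h2 h3 ⊢
      field_simp
      ring
    rw [hf'] at h1
    simp only [map_add, map_div₀, map_pow, map_one, Complex.conj_conj] at h1 h2 h3
    have h4 := pow_ne_zero (k + 1) (mul_ne_zero h3 hq)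
    refine mul_right_cancel₀ h4 ?_
    have h2' := pow_ne_zero (k + 1) h2
    have h3' := pow_ne_zero (k + 1) h3
    field_simp at h1
    have h5 := congrArg (· ^ (k + 1)) hq'
    simp only [mul_pow] at h5 h1 ⊢
    linear_combination conj E * h5 - h1
  obtain ⟨ε, hε⟩ := Complex.conj_eq_iff_real.1 hEr
  refine ⟨P, r, ε, ?_, fun w => ⟨hne w, hg' w, by rw [hf', hε]⟩⟩
  rintro rfl
  exact hE0 (by rw [hε]; simp)

/-- If `r = 0`, then `g` is constant. Otherwise `α = 2 / r` and `β = -α P`: absence of a pole gives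
`Re P ≥ 0`, positivity of `Re g` gives `r ≤ (Re P)²`, and the sign of `r` selects the alternative.
-/
theorem hermitianFamily_of_normalForm {ℓ : ℕ} {f : RHP → ℂ} {g : RHP → RHP} {P : ℂ} {r ε : ℝ}
    (hε : ε ≠ 0) (h : ∀ w : RHP, (w : ℂ) + conj P ≠ 0 ∧
      (g w : ℂ) = P - r / (w + conj P) ∧ f w = ε / (w + conj P) ^ (ℓ + 2)) :
    HermitianFamilyConst ℓ f g ∨ HermitianFamilyFractional ℓ f g := by
  by_cases hr : r = 0
  · left
    have hg : ∀ w : RHP, (g w : ℂ) = P := fun w => by rw [(h w).2.1, hr]; simp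
    refine ⟨P, ε, ?_, fun w => ⟨hg w, (h w).2.2⟩⟩
    rw [← hg ⟨1, rhp_one⟩]
    exact (g _).2
  right
  have hp : 0 ≤ P.re := by
    by_contra hneg
    refine (h ⟨-conj P, by simpa using hneg⟩).1 ?_
    simp
  -- On the line `Im z = Im P` the denominator `z + conj P` is real.
  have hpos : ∀ x : ℝ, 0 < x → r < P.re * (x + P.re) := by
    intro x hx
    have hz : 0 < ((x : ℂ) + P.im * Complex.I).re := by simpa using hx
    have h1 := (g ⟨_, hz⟩).2
    rw [Set.mem_ofPred_eq, (h _).2.1] at h1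
    have e : ((x : ℂ) + P.im * Complex.I) + conj P = ((x + P.re : ℝ) : ℂ) := by
      apply Complex.ext <;> simp
    simp only at h1
    rw [e, ← Complex.ofReal_div, Complex.sub_re, Complex.ofReal_re, sub_pos,
      div_lt_iff₀ (by linarith)] at h1
    exact h1
  have hr' : (r : ℂ) ≠ 0 := by exact_mod_cast hr
  refine ⟨2 / r, ε * (2 / r) ^ (ℓ + 2), -(2 / r) * P, by positivity, by positivity, ?_,
    fun w => ?_⟩
  · have hle : r ≤ P.re ^ 2 := by
      by_contra hlt
      push Not at hlt
      rcases hp.eq_or_lt with h0 | h0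
      · have := hpos 1 one_pos
        rw [← h0] at this hlt
        norm_num at this hlt
        linarith
      -- At this `x` the bound reads `r < r`.
      · have := hpos ((r - P.re ^ 2) / P.re) (div_pos (by linarith) h0)
        rw [mul_add, mul_div_cancel₀ _ h0.ne'] at this
        linarith
    have e : (-(2 / r : ℂ) * P).re = -(2 / r) * P.re := by
      rw [← Complex.ofReal_ofNat, ← Complex.ofReal_div, ← Complex.ofReal_neg, Complex.re_ofReal_mul]
    rw [e]
    rcases lt_or_gt_of_ne hr with h0 | h0
    · right
      have : 2 / r < 0 := div_neg_of_pos_of_neg two_pos h0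
      exact ⟨this, mul_nonneg (by linarith) hp⟩
    · left
      have h2 : 0 < 2 / r := by positivity
      have hp' : 0 < P.re := by
        rcases hp.eq_or_lt with h3 | h3
        · rw [← h3] at hle; norm_num at hle; linarith
        · exact h3
      refine ⟨by nlinarith, h2, ?_⟩
      rw [mul_pow, neg_sq, div_pow]
      field_simp
      linarith
  · obtain ⟨h1, h2, h3⟩ := h w
    have e : ((2 / r : ℝ) : ℂ) * w - conj (-(2 / r : ℂ) * P) = 2 / r * (w + conj P) := by
      simp only [map_mul, map_neg, map_div₀, map_ofNat, Complex.conj_ofReal, Complex.ofReal_div,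
        Complex.ofReal_ofNat]
      ring
    rw [e, h2, h3]
    constructor
    · push_cast
      field_simp
    · push_cast
      rw [mul_pow, mul_comm (ε : ℂ),
        mul_div_mul_left _ _ (pow_ne_zero _ (div_ne_zero two_ne_zero hr'))]

/-- Classification of the nonzero solutions of the kernel identity. -/
theorem HermitianKernelIdentity.hermitianFamily {ℓ : ℕ} {f : RHP → ℂ} {g : RHP → RHP}
    (hk : HermitianKernelIdentity (ℓ + 2) f g) (hf : IsAnalytic f)
    (hg : IsAnalytic fun z => (g z : ℂ)) (hne : ¬ ∀ z, f z = 0) :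
    HermitianFamilyConst ℓ f g ∨ HermitianFamilyTranslation f g ∨
      HermitianFamilyFractional ℓ f g := by
  obtain ⟨A, m, B, F₀, hF₀, h⟩ := HermitianKernelIdentity.exists_linearFractional hk hf hg hne
  by_cases hm : m = 0
  · right; left
    simp only [hm, zero_mul, sub_zero] at h
    have hA := (h ⟨1, rhp_one⟩).1
    have hA' := pow_ne_zero (ℓ + 1 + 1) hA
    refine HermitianKernelIdentity.translation_of_affine (κ := 1 / A) (τ := B / A - 1)
      (c := F₀ / A ^ (ℓ + 1 + 1)) hk (div_ne_zero hF₀ hA') fun w => ⟨?_, ?_⟩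
    · have := (h w).2.1
      field_simp
      linear_combination this
    · rw [← (h w).2.2]
      field_simp
  · obtain ⟨P, r, ε, hε, h'⟩ := HermitianKernelIdentity.exists_normalForm hk hm hF₀ h
    rcases hermitianFamily_of_normalForm hε h' with h1 | h1
    · exact .inl h1
    · exact .inr (.inr h1)

/-! ### The families satisfy the identity and are bounded -/

section Families

variable {ℓ : ℕ} {f : RHP → ℂ} {g : RHP → RHP}

theorem HermitianKernelIdentity.of_eq_zero {n : ℕ} (h : ∀ z, f z = 0) :
    HermitianKernelIdentity n f g := fun z w => by simp [h]

theorem isBoundedOperator_of_eq_zero (hf : IsAnalytic f) (hg : IsAnalytic fun z => (g z : ℂ))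
    (h : ∀ z, f z = 0) : IsBoundedOperator (maxWeightedComp ℓ f g) :=
  .of_lintegral_le hf hg 0 le_rfl fun k => by simp [weightedComp, h]

theorem HermitianFamilyConst.kernelIdentity (h : HermitianFamilyConst ℓ f g) :
    HermitianKernelIdentity (ℓ + 2) f g := by
  obtain ⟨μ, ε, hμ, h⟩ := h
  intro z w
  have h1 := pow_ne_zero (ℓ + 2) (add_conj_ne_zero z.2 hμ)
  have h2 := pow_ne_zero (ℓ + 2) ((map_ne_zero conj).2 (add_conj_ne_zero w.2 hμ))
  rw [(h z).1, (h z).2, (h w).1, (h w).2]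
  simp only [map_add, map_div₀, map_pow, Complex.conj_conj, Complex.conj_ofReal] at h2 ⊢
  rw [add_comm μ]
  field_simp

/-- The operator has rank at most one, `k ↦ ε k(μ) K_μ`, and point evaluation is bounded. -/
theorem HermitianFamilyConst.isBoundedOperator (h : HermitianFamilyConst ℓ f g)
    (hf : IsAnalytic f) (hg : IsAnalytic fun z => (g z : ℂ)) :
    IsBoundedOperator (maxWeightedComp ℓ f g) := by
  obtain ⟨μ, ε, hμ, h⟩ := h
  set K := BergmanSpace.kernel ℓ ⟨μ, hμ⟩ with hK
  set c : ℝ := 2 ^ ℓ * (ℓ + 1) * ‖K‖ with hc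
  refine .of_lintegral_le hf hg ((|ε| * c * ‖K‖) ^ 2) (by positivity) fun k => ?_
  have hfun : ∀ z, weightedComp f g k z = ((ε * k ⟨μ, hμ⟩ : ℂ) • K) z := fun z => by
    have hgz : g z = ⟨μ, hμ⟩ := Subtype.ext (h z).1
    rw [weightedComp, hgz, (h z).2, BergmanSpace.smul_apply, hK, BergmanSpace.kernel_apply]
    ring
  simp only [hfun]
  rw [← BergmanSpace.ofReal_norm_sq, ← mul_pow]
  refine ENNReal.ofReal_le_ofReal (pow_le_pow_left₀ (norm_nonneg _) ?_ 2)
  rw [norm_smul, norm_mul, Complex.norm_real, Real.norm_eq_abs]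
  calc |ε| * ‖k ⟨μ, hμ⟩‖ * ‖K‖ ≤ |ε| * (c * ‖k‖) * ‖K‖ := by
        gcongr
        exact BergmanSpace.norm_apply_le _ _
    _ = _ := by ring

theorem HermitianFamilyTranslation.kernelIdentity {n : ℕ} (h : HermitianFamilyTranslation f g) :
    HermitianKernelIdentity n f g := by
  obtain ⟨γ, c, -, h⟩ := h
  intro z w
  rw [(h z).1, (h z).2, (h w).1, (h w).2, map_add, Complex.conj_ofReal, Complex.conj_ofReal]
  ring

theorem HermitianFamilyTranslation.isBoundedOperator (h : HermitianFamilyTranslation f g)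
    (hf : IsAnalytic f) (hg : IsAnalytic fun z => (g z : ℂ)) :
    IsBoundedOperator (maxWeightedComp ℓ f g) := by
  obtain ⟨γ, c, hγ, h⟩ := h
  refine .of_injOn hf hg (G := fun z => z + γ) (G' := fun _ => 1) (fun z => (h z).1.symm)
    (fun z _ => (hasDerivAt_id z).add_const _) (fun a _ b _ hab => add_right_cancel hab)
    (c ^ 2) (by positivity) fun z => ?_
  have hz : 0 < (z : ℂ).re := z.2
  rw [(h z).1, (h z).2, Complex.norm_real, Real.norm_eq_abs, sq_abs, norm_one, one_pow, one_mul,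
    Complex.add_re, Complex.ofReal_re]
  gcongr
  linarith

theorem denominator_ne_zero_of_fractional {α : ℝ} {β : ℂ}
    (hαβ : (β.re < 0 ∧ 0 < α ∧ α ≤ β.re ^ 2 / 2) ∨ (α < 0 ∧ 0 ≤ β.re)) {z : ℂ} (hz : 0 < z.re) :
    (α * z - conj β) ≠ 0 := by
  intro h0
  have := congrArg Complex.re h0
  simp at this
  rcases hαβ with ⟨h1, h2, -⟩ | ⟨h1, h2⟩ <;> nlinarith

/-- With `u = α z - conj β` and `v = α w - conj β`, the quotient `(z + conj (g w)) / u` equals `1 /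
α - 2 / (u * conj v)`, which is hermitian in `(z, w)`. -/
theorem HermitianFamilyFractional.kernelIdentity (h : HermitianFamilyFractional ℓ f g) :
    HermitianKernelIdentity (ℓ + 2) f g := by
  obtain ⟨α, δ, β, hα, hδ, hαβ, h⟩ := h
  intro z w
  have hα' : (α : ℂ) ≠ 0 := by exact_mod_cast hα
  have h1 := denominator_ne_zero_of_fractional hαβ z.2
  have h2 := (map_ne_zero conj).2 (denominator_ne_zero_of_fractional hαβ w.2)
  rw [(h z).1, (h z).2, (h w).1, (h w).2]
  simp only [map_sub, map_mul, map_neg, map_div₀, map_pow, map_ofNat, Complex.conj_conj,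
    Complex.conj_ofReal] at h2 ⊢
  rw [div_mul_eq_mul_div, div_mul_eq_mul_div, mul_div_assoc, mul_div_assoc, ← div_pow, ← div_pow]
  congr 2
  rw [div_eq_div_iff h1 h2]
  linear_combination (z : ℂ) * div_mul_cancel₀ β hα' -
    conj (w : ℂ) * div_mul_cancel₀ (conj β) hα' + div_mul_cancel₀ (2 : ℂ) h1 -
    div_mul_cancel₀ (2 : ℂ) h2

/-- The quantitative form of the fact that the symbols of the third family preserve the
half-plane. -/
theorem two_mul_abs_mul_re_le_of_fractional {α : ℝ} {β : ℂ}
    (hαβ : (β.re < 0 ∧ 0 < α ∧ α ≤ β.re ^ 2 / 2) ∨ (α < 0 ∧ 0 ≤ β.re)) {z : ℂ} (hz : 0 < z.re) :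
    2 * |α| * z.re / ‖α * z - conj β‖ ^ 2 ≤ (-β / α - 2 / (α * z - conj β)).re := by
  have h0 := denominator_ne_zero_of_fractional hαβ hz
  have hn := norm_pos_iff.2 h0
  set u : ℂ := α * z - conj β with hu
  have hure : u.re = α * z.re - β.re := by simp [hu]
  have e1 : (-β / α - 2 / u).re = -β.re / α - 2 * u.re / ‖u‖ ^ 2 := by
    rw [Complex.sub_re, Complex.div_ofReal_re, Complex.neg_re, Complex.div_re,
      Complex.normSq_eq_norm_sq]
    simp
  have hnorm : u.re ^ 2 ≤ ‖u‖ ^ 2 := by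
    rw [← sq_abs]
    exact pow_le_pow_left₀ (abs_nonneg _) (Complex.abs_re_le_norm u) 2
  rw [e1, div_le_iff₀ (by positivity), sub_mul, div_mul_cancel₀ _ (by positivity)]
  rcases hαβ with ⟨h1, h2, h3⟩ | ⟨h1, h2⟩
  · rw [abs_of_pos h2]
    -- This is the condition `α ≤ (Re β)² / 2` rearranged. After replacing `‖u‖` by `u.re`, the
    -- surplus is a nonnegative multiple of `(α Re z)²`.
    have h4 : 2 / (-β.re) ≤ -β.re / α := by
      rw [div_le_div_iff₀ (by linarith) h2]
      linarith
    have h5 : 2 / (-β.re) * u.re ^ 2 ≤ -β.re / α * ‖u‖ ^ 2 :=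
      mul_le_mul h4 hnorm (sq_nonneg _) (by have : 0 < -β.re := by linarith
                                            positivity)
    refine le_trans ?_ (sub_le_sub_right h5 _)
    rw [hure, div_mul_eq_mul_div, le_sub_iff_add_le, le_div_iff₀ (by linarith)]
    nlinarith [mul_pos h2 hz, mul_pos (mul_pos h2 hz) (mul_pos h2 hz)]
  · rw [abs_of_neg h1, hure]
    have h4 : 0 ≤ -β.re / α := div_nonneg_of_nonpos (by linarith) h1.le
    have h5 : 0 ≤ -β.re / α * ‖u‖ ^ 2 := by positivity
    linarith

/-- The lower bound `Re g ≥ 2|α| Re z / |α z - conj β|²` makes `|g'|² (Re g)^ℓ` carry the same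
powers of `Re z` and of the denominator as `|f|² (Re z)^ℓ`; the constant `δ² / (2|α|)^(ℓ+2)` is the
remaining ratio. -/
theorem HermitianFamilyFractional.isBoundedOperator (h : HermitianFamilyFractional ℓ f g)
    (hf : IsAnalytic f) (hg : IsAnalytic fun z => (g z : ℂ)) :
    IsBoundedOperator (maxWeightedComp ℓ f g) := by
  obtain ⟨α, δ, β, hα, hδ, hαβ, h⟩ := h
  have hα' : (α : ℂ) ≠ 0 := by exact_mod_cast hα
  refine .of_injOn hf hg (G := fun z => -β / α - 2 / (α * z - conj β))
    (G' := fun z => 2 * α / (α * z - conj β) ^ 2) (fun z => (h z).1.symm) (fun z hz => ?_)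
    (fun a ha b hb hab => ?_) (δ ^ 2 / (2 * |α|) ^ (ℓ + 2)) (by positivity) fun z => ?_
  · have h0 := denominator_ne_zero_of_fractional hαβ hz
    have h1 : HasDerivAt (fun z : ℂ => α * z - conj β) α z := by
      simpa using ((hasDerivAt_id z).const_mul (α : ℂ)).sub_const (conj β)
    refine (((hasDerivAt_const z (2 : ℂ)).div h1 h0).const_sub (-β / α)).congr_deriv ?_
    field_simp
    ring
  · have h1 : 2 / (α * a - conj β) = 2 / (α * b - conj β) := sub_right_injective hab
    have ha' := denominator_ne_zero_of_fractional hαβ ha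
    have hb' := denominator_ne_zero_of_fractional hαβ hb
    rw [div_eq_div_iff ha' hb'] at h1
    refine mul_left_cancel₀ hα' ?_
    linear_combination -h1 / 2
  · have hz : 0 < (z : ℂ).re := z.2
    have h0 := norm_pos_iff.2 (denominator_ne_zero_of_fractional hαβ hz)
    have h1 := two_mul_abs_mul_re_le_of_fractional hαβ hz
    rw [(h z).1, (h z).2]
    refine le_trans (le_of_eq ?_) (mul_le_mul_of_nonneg_left (mul_le_mul_of_nonneg_left
      (pow_le_pow_left₀ (by positivity) h1 ℓ) (by positivity)) (by positivity))
    have hα0 : |α| ≠ 0 := abs_ne_zero.2 hα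
    simp only [norm_div, norm_mul, norm_pow, Complex.norm_real, Real.norm_eq_abs,
      Complex.norm_ofNat]
    generalize ‖(α : ℂ) * z - conj β‖ = n at h0
    rw [div_pow |δ|, sq_abs, div_pow _ (n ^ 2) ℓ]
    field_simp
    ring

end Families

theorem mainTheorem2 (ℓ : ℕ) (f : RHP → ℂ) (g : RHP → RHP)
    (hf : IsAnalytic f) (hg : IsAnalytic fun z => (g z : ℂ))
    (W : BergmanSpace ℓ →ₗ.[ℂ] BergmanSpace ℓ) (hW : W ≤ maxWeightedComp ℓ f g) :
    (IsSelfAdjoint W ↔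
      W = maxWeightedComp ℓ f g ∧
        ((∀ z, f z = 0) ∨ HermitianFamilyConst ℓ f g ∨ HermitianFamilyTranslation f g ∨
          HermitianFamilyFractional ℓ f g)) ∧
    (IsSelfAdjoint W → IsBoundedOperator W) := by
  have hfam : ((∀ z, f z = 0) ∨ HermitianFamilyConst ℓ f g ∨ HermitianFamilyTranslation f g ∨
      HermitianFamilyFractional ℓ f g) →
      IsBoundedOperator (maxWeightedComp ℓ f g) ∧ HermitianKernelIdentity (ℓ + 2) f g := by
    rintro (h | h | h | h)
    · exact ⟨isBoundedOperator_of_eq_zero hf hg h, .of_eq_zero h⟩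
    · exact ⟨h.isBoundedOperator hf hg, h.kernelIdentity⟩
    · exact ⟨h.isBoundedOperator hf hg, h.kernelIdentity⟩
    · exact ⟨h.isBoundedOperator hf hg, h.kernelIdentity⟩
  have hmp : IsSelfAdjoint W → W = maxWeightedComp ℓ f g ∧
      ((∀ z, f z = 0) ∨ HermitianFamilyConst ℓ f g ∨ HermitianFamilyTranslation f g ∨
        HermitianFamilyFractional ℓ f g) := by
    intro hsa
    have hk := HermitianKernelIdentity.of_isSelfAdjoint hW hsa
    have h := or_iff_not_imp_left.2 (hk.hermitianFamily hf hg)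
    obtain ⟨hb, hk'⟩ := hfam h
    exact ⟨eq_of_le_of_isSelfAdjoint hW hsa (hb.isSelfAdjoint hk'), h⟩
  refine ⟨⟨hmp, ?_⟩, fun hsa => ?_⟩
  · rintro ⟨rfl, h⟩
    obtain ⟨hb, hk⟩ := hfam h
    exact hb.isSelfAdjoint hk
  · obtain ⟨rfl, h⟩ := hmp hsa
    exact (hfam h).1
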